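/- \textbf{Setting.} Let $\Sigma$ be a finite system of equations $P(\xi,\xi')=0$ in a finite set $\Xi$ of variables, where the functions $P$ are analytic on an open set of values of $(\xi,\xi')=(x,x')_{x\in\Xi}$ and do not depend explicitly on the time $t$. For $P\in\Sigma$ and $x\in\Xi$, let $\mathrm{ord}_xP\in\{-\infty,0,1\}$ be the order of $P$ in $x$ ($-\infty$ if neither $x$ nor $x'$ occurs in $P$), and for $A\subset\Sigma$, $Y\subset\Xi$ let $\mathcal O_{Y,A}$ be the Jacobi number, i.e. the maximum of $\sum_{P\in A}\mathrm{ord}_{\sigma(P)}P$ over all injections $\sigma:A\to Y$ ($-\infty$ if there is none). Assume that $\Sigma$ is an order $1$ block triangular system: there are partitions $\Sigma=\bigcup_{h=1}^{p}\Sigma_h$ and $\Xi=\bigcup_{h=0}^{p}\Xi_h$ such that the equations of $\Sigma_h$ depend only on the variables of $\bigcup_{k\le h}\Xi_k$, with order at most $1$ in the variables of $\Xi_{h-1}$ and at most $0$ in the others, and, for all $1\le h\le p$, $\sharp\Xi_{h-1}=\sharp\Sigma_h$, $\mathcal O_{\Xi_{h-1},\Sigma_h}=\sharp\Xi_{h-1}$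 and $\mathcal O_{\Xi_h,\Sigma_h}=0$. The system is chained at level $h$ if the equations of $\Sigma_h$ involve only the variables of $\Xi_h\cup\Xi_{h-1}$, and strictly chained at level $h$ if moreover they involve the derivatives $x'$ of the variables $x\in\Xi_{h-1}$ but not those variables themselves. Let $V$ be the subset of the jet space $\mathbf J(\mathbb R,\mathbb R^{\Xi})$, with coordinates $t$, $x^{(k)}$ ($x\in\Xi$, $k\in\mathbb N$), the product topology and the Cartan derivation $\mathrm d_t=\partial_t+\sum_{x,k}x^{(k+1)}\partial_{x^{(k)}}$, defined by the vanishing of all $P\in\Sigma$ and of all their iterated Cartan derivatives. $\Sigma$ is flat at $\eta\in V$ if some neighbourhood of $\eta$ in $V$ is isomorphic, by a $\mathcal C^\infty$ diffeomorphism (each of whose coordinates depends on finitely many coordinates) compatible with the Cartan derivations, to an open subset of $\mathbf J(\mathbb R,\mathbb R^m)$ for some $m$. For a function $g$ on the jet space let $\mathrm j_\eta(g)=\sum_{k}\frac{(\mathrm d_t^kg)(\eta)}{k!}\tau^k$; the linearized system at $\eta$ is the system $\sum_{x}\mathrm j_\eta(\partial P/\partial x)\,\mathrm dx+\mathrm j_\eta(\partial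 P/\partial x')\,\mathrm dx'=0$, $P\in\Sigma$, and defines a left module over $\mathbb R[\![\tau]\!][\mathrm d/\mathrm d\tau]$, the quotient of the free module on the $\mathrm dx$, $x\in\Xi$, by the submodule generated by these equations. \textbf{Theorem.} Let $2\le h_0\le p$, and let $\Sigma$ be chained at level $h_0$ and strictly chained at level $h_0-1$. Let a smooth trajectory of $\Sigma$, defined on an open interval, be given, along which every variable, or derivative of a variable, that appears nonlinearly in an equation of $\Sigma_{h_0-1}\cup\Sigma_{h_0}$ is constant (a quantity $v$ appears linearly in $P$ if $\partial P/\partial v$ is constant on the domain of definition, and nonlinearly otherwise). Let $\eta$ be a point of this trajectory, i.e. its jet at some time. Assume that the Jacobian matrix $$\left(\frac{\partial P}{\partial x}(\eta)\ \Big|\ (P,x)\in\Sigma_{h_0}\times\Xi_{h_0}\right)$$ has rank $m_0<\sharp\Xi_{h_0-2}$, and that, for all $1\le h\le p$, the Jacobian determinant $$\left|\frac{\partial P}{\partial x'}\ \Big|\ (P,x)\in\Sigma_{h}\times\Xi_{h-1}\right|$$ does not vanish at $\eta$. Then the module defined by the linearized system at $\eta$ has a nonzero torsion element, and $\Sigma$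 is not flat at $\eta$. -/

import Mathlib

open scoped ContDiff

noncomputable section

namespace FlatSing

/-! ### Jet space, Cartan derivation, smooth functions -/

/-- The infinite jet space of maps from `ℝ` to `ℝ^ι`, with coordinates `t` and `x_i^{(k)}`:
a point is `(t, x)` with `x k i = x_i^{(k)}`. It carries the product topology. -/
abbrev Jet (ι : Type*) : Type _ := ℝ × (ℕ → ι → ℝ)

/-- The space of the coordinates `t`, `x_i^{(k)}`, `k < N`. -/
abbrev TruncJet (ι : Type*) (N : ℕ) : Type _ := ℝ × (Fin N → ι → ℝ)

/-- The space of the coordinates `x_i`, `x_i'` (without time): `z 0 = x` and `z 1 = x'`. -/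
abbrev FirstJet (ι : Type*) : Type _ := Fin 2 → ι → ℝ

/-- Forget the coordinates of order at least `N`. -/
def trunc {ι : Type*} (N : ℕ) (q : Jet ι) : TruncJet ι N := (q.1, fun k i => q.2 k i)

/-- The values `(x, x')` at a point of the jet space. -/
def firstJet {ι : Type*} (q : Jet ι) : FirstJet ι := fun k i => q.2 k i

/-- The Cartan vector field `∂_t + ∑ x_i^{(k+1)} ∂/∂x_i^{(k)}` at the point `q`. -/
def cartan {ι : Type*} (q : Jet ι) : Jet ι := (1, fun k i => q.2 (k + 1) i)

/-- The Cartan (total) derivative of a function on the jet space: its derivative in the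
direction of the Cartan vector field. -/
def totalDeriv {ι : Type*} (F : Jet ι → ℝ) (q : Jet ι) : ℝ := lineDeriv ℝ F q (cartan q)

/-- `F` is, on the open set `O`, a smooth function of a finite number of coordinates. -/
def IsSmoothOn {ι : Type*} [Fintype ι] (F : Jet ι → ℝ) (O : Set (Jet ι)) : Prop :=
  ∃ (N : ℕ) (g : TruncJet ι N → ℝ),
    ContDiffOn ℝ ∞ g (trunc N '' O) ∧ ∀ q ∈ O, F q = g (trunc N q)

/-- On the open subset `X ∩ O` of the subdiffiety `X` of the jet space, `f` is a smooth function
(depending on a finite number of coordinates) and its Cartan derivative is `f'`. -/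
def HasCartanDeriv {ι : Type*} [Fintype ι] (X O : Set (Jet ι)) (f f' : Jet ι → ℝ) : Prop :=
  ∃ F : Jet ι → ℝ, IsSmoothOn F O ∧
    (∀ q ∈ X ∩ O, f q = F q) ∧ (∀ q ∈ X ∩ O, f' q = totalDeriv F q)

/-- `φ` is a morphism of diffieties from the open subset `X ∩ O` of `X` to a jet space: its
components are smooth functions, and it is compatible with the Cartan derivations
(`δ (t ∘ φ) = 1` and `δ (z_j^{(k)} ∘ φ) = z_j^{(k+1)} ∘ φ`). -/
def IsDiffietyMorphismOn {ι κ : Type*} [Fintype ι] (X O : Set (Jet ι))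
    (φ : Jet ι → Jet κ) : Prop :=
  HasCartanDeriv X O (fun q => (φ q).1) (fun _ => 1) ∧
  ∀ (k : ℕ) (j : κ), HasCartanDeriv X O (fun q => (φ q).2 k j) (fun q => (φ q).2 (k + 1) j)

/-- `η` is a flat point of the subdiffiety `X`: some neighbourhood `X ∩ O` of `η` in `X` is
isomorphic, as a diffiety, to an open subset `O'` of the jet space of maps from `ℝ` to `ℝ^m`,
for some `m`. -/
def IsFlatAt {ι : Type*} [Fintype ι] (X : Set (Jet ι)) (η : Jet ι) : Prop :=
  η ∈ X ∧
  ∃ (m : ℕ) (O : Set (Jet ι)) (O' : Set (Jet (Fin m)))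
    (φ : Jet ι → Jet (Fin m)) (ψ : Jet (Fin m) → Jet ι),
    IsOpen O ∧ η ∈ O ∧ IsOpen O' ∧
    Set.MapsTo φ (X ∩ O) O' ∧ Set.MapsTo ψ O' (X ∩ O) ∧
    Set.LeftInvOn ψ φ (X ∩ O) ∧ Set.RightInvOn ψ φ O' ∧
    IsDiffietyMorphismOn X O φ ∧ IsDiffietyMorphismOn Set.univ O' ψ

/-! ### Differential systems of order one -/

/-- A system of equations `P_e(x, x') = 0`, `e ∈ E`, in the variables `V`, analytic on an open
set of definition. -/
structure DiffSystem (V E : Type*) [Fintype V] where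
  dom : Set (FirstJet V)
  isOpen_dom : IsOpen dom
  P : E → FirstJet V → ℝ
  analytic : ∀ e, AnalyticOnNhd ℝ (P e) dom

namespace DiffSystem

variable {V E : Type*} [Fintype V] [DecidableEq V] (S : DiffSystem V E)

/-- The partial derivative `∂P_e/∂x^{(k)}`, `k = 0, 1`. -/
def pd (e : E) (k : Fin 2) (x : V) (z : FirstJet V) : ℝ :=
  fderiv ℝ (S.P e) z (Pi.single k (Pi.single x 1))

/-- `P_e` depends on `x^{(k)}`. -/
def DependsOn (e : E) (k : Fin 2) (x : V) : Prop := ∃ z ∈ S.dom, S.pd e k x z ≠ 0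

/-- `x^{(k)}` appears nonlinearly in `P_e`, i.e. `P_e` is not the sum of `a x^{(k)}`, with `a` a
constant, and of a function that does not depend on `x^{(k)}`. -/
def AppearsNonlinearly (e : E) (k : Fin 2) (x : V) : Prop :=
  ¬ ∃ a : ℝ, ∀ z ∈ S.dom, S.pd e k x z = a

open Classical in
/-- The order of `P_e` in the variable `x`; it is `-∞` if `P_e` is free from `x` and `x'`. -/
def ord (e : E) (x : V) : WithBot ℕ :=
  if S.DependsOn e 1 x then 1 else if S.DependsOn e 0 x then 0 else ⊥

open Classical in
/-- The Jacobi number of the equations `A` considered as a system in the variables `Y`: the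
maximum of `∑_{e ∈ A} ord_{σ(e)} P_e` over all injections `σ : A → Y` (`-∞` if there is none). -/
def jacobiNumber [Fintype E] (A : Set E) (Y : Set V) : WithBot ℕ :=
  (Finset.univ : Finset (A ↪ Y)).sup (fun σ => ∑ e : A, S.ord (e : E) (σ e : V))

/-- The subdiffiety of the jet space defined by the system: the zeros of all the `P_e` and
of all their Cartan derivatives. -/
def diffiety : Set (Jet V) :=
  {q | firstJet q ∈ S.dom ∧
    ∀ (e : E) (k : ℕ), (totalDeriv^[k] (fun r => S.P e (firstJet r))) q = 0}

/-- The smooth curve `x`, defined on the open interval `I`, is a trajectory of the system. -/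
structure IsTrajectory (I : Set ℝ) (x : ℝ → V → ℝ) : Prop where
  isOpen : IsOpen I
  ordConnected : I.OrdConnected
  smooth : ContDiffOn ℝ ∞ x I
  mem_dom : ∀ t ∈ I, (fun k : Fin 2 => iteratedDeriv k x t) ∈ S.dom
  solution : ∀ t ∈ I, ∀ e, S.P e (fun k : Fin 2 => iteratedDeriv k x t) = 0

end DiffSystem

/-- The jet at time `t` of a curve, a point of the jet space. -/
def curveJet {V : Type*} [Fintype V] (x : ℝ → V → ℝ) (t : ℝ) : Jet V :=
  (t, fun k => iteratedDeriv k x t)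

/-! ### Block triangular systems -/

/-- The block `Ξ_h`, where `lv x` is the index of the block that contains the variable `x`;
also used for the blocks `Σ_h` of equations. -/
abbrev Block {V : Type*} (lv : V → ℕ) (h : ℕ) : Type _ := {x : V // lv x = h}

namespace DiffSystem

variable {V E : Type*} [Fintype V] [DecidableEq V] [Fintype E] (S : DiffSystem V E)

/-- The partitions `V = Ξ_0 ∪ ⋯ ∪ Ξ_p` and `E = Σ_1 ∪ ⋯ ∪ Σ_p`, given by the block indices `lv`
and `le`, make the system an order one block triangular system. -/
structure IsBlockTriangular (p : ℕ) (lv : V → ℕ) (le : E → ℕ) : Prop where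
  lv_le : ∀ x, lv x ≤ p
  one_le_le : ∀ e, 1 ≤ le e
  le_le : ∀ e, le e ≤ p
  /-- The equations of `Σ_h` depend only on the variables of `Ξ_0, …, Ξ_h` … -/
  level_le : ∀ e x, S.ord e x ≠ ⊥ → lv x ≤ le e
  /-- … and have order at most `0` in those that do not belong to `Ξ_{h-1}`. -/
  order_le : ∀ e x, lv x + 1 ≠ le e → S.ord e x ≤ 0
  card_eq : ∀ h, 1 ≤ h → h ≤ p → Nat.card (Block lv (h - 1)) = Nat.card (Block le h)
  jacobi_prev : ∀ h, 1 ≤ h → h ≤ p →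
    S.jacobiNumber {e | le e = h} {x | lv x = h - 1} = (Nat.card (Block lv (h - 1)) : WithBot ℕ)
  jacobi_self : ∀ h, 1 ≤ h → h ≤ p →
    S.jacobiNumber {e | le e = h} {x | lv x = h} = 0

/-- The system is chained at level `h`: the equations of `Σ_h` depend only on the variables of
`Ξ_h ∪ Ξ_{h-1}` (and their derivatives). -/
def IsChainedAt (lv : V → ℕ) (le : E → ℕ) (h : ℕ) : Prop :=
  ∀ e x, le e = h → S.ord e x ≠ ⊥ → lv x = h ∨ lv x + 1 = h

/-- The system is strictly chained at level `h`: moreover, the equations of `Σ_h` depend on the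
derivatives of the variables of `Ξ_{h-1}`, but not on those variables themselves. -/
def IsStrictlyChainedAt (lv : V → ℕ) (le : E → ℕ) (h : ℕ) : Prop :=
  S.IsChainedAt lv le h ∧ ∀ e x, le e = h → lv x + 1 = h → ¬ S.DependsOn e 0 x

/-- The Jacobian matrix `(∂P/∂x^{(k)})`, `P ∈ Σ_i`, `x ∈ Ξ_j`, at a point of the jet space. -/
def jacobian (lv : V → ℕ) (le : E → ℕ) (k : Fin 2) (i j : ℕ) (η : Jet V) :
    Matrix (Block le i) (Block lv j) ℝ :=
  Matrix.of fun e x => S.pd e k x (firstJet η)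

end DiffSystem

/-! ### The linearized system at a point -/

/-- The Taylor series `∑ g^{(k)}(η) τ^k / k!` of a function on the jet space at `η`, where
`g^{(k)}` is the iterated Cartan derivative. -/
def taylorSeries {V : Type*} (η : Jet V) (g : Jet V → ℝ) : PowerSeries ℝ :=
  PowerSeries.mk fun k => (totalDeriv^[k] g) η / (k.factorial : ℝ)

/-- The free left `ℝ⟦τ⟧[d/dτ]`-module on the symbols `dx`, `x ∈ V`, i.e. the free `ℝ⟦τ⟧`-module
on the symbols `dx^{(k)}`. -/
abbrev Forms (V : Type*) : Type _ := (ℕ × V) →₀ PowerSeries ℝ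

/-- The action of `d/dτ`: `a dx^{(k)} ↦ a' dx^{(k)} + a dx^{(k+1)}`. -/
def formDeriv {V : Type*} (w : Forms V) : Forms V :=
  w.sum fun v a => Finsupp.single v (PowerSeries.derivative ℝ a) + Finsupp.single (v.1 + 1, v.2) a

/-- The action on `w` of the linear differential operator `∑_j L_j (d/dτ)^j`. -/
def opApply {V : Type*} (L : ℕ →₀ PowerSeries ℝ) (w : Forms V) : Forms V :=
  L.sum fun j a => a • formDeriv^[j] w

namespace DiffSystem

variable {V E : Type*} [Fintype V] [DecidableEq V] (S : DiffSystem V E)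

/-- The linearized equation `∑ j_η(∂P_e/∂x) dx + ∑ j_η(∂P_e/∂x') dx' = 0` at `η`, where `j_η` is
the Taylor series. -/
def linearizedEq (η : Jet V) (e : E) : Forms V :=
  ∑ k : Fin 2, ∑ x : V,
    Finsupp.single ((k : ℕ), x) (taylorSeries η fun q => S.pd e k x (firstJet q))

/-- The submodule generated by the linearized equations and all their derivatives. -/
def linearizedRelations (η : Jet V) : Submodule (PowerSeries ℝ) (Forms V) :=
  Submodule.span (PowerSeries ℝ) {w | ∃ (e : E) (k : ℕ), w = formDeriv^[k] (S.linearizedEq η e)}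

/-- The `ℝ⟦τ⟧[d/dτ]`-module defined by the linearized system at `η` has a nonzero torsion
element: a nonzero class annihilated by a nonzero operator. -/
def LinearizedHasTorsion (η : Jet V) : Prop :=
  ∃ w : Forms V, w ∉ S.linearizedRelations η ∧
    ∃ L : ℕ →₀ PowerSeries ℝ, L ≠ 0 ∧ opApply L w ∈ S.linearizedRelations η

end DiffSystem

end FlatSing

end

/-! Write `h` for the level called $h_0$ in the theorem. Take the combinations of the differentials
of the equations of levels `h - 1` and `h` in which the order-zero terms vanish at `η`. By chaining,
only the terms in $\Xi_h$ and $\Xi_{h-1}$ have to be killed. Left null vectors of the Jacobian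
matrix dispose of $\Xi_h$. A dimension count then leaves more unknowns than the $\sharp\Xi_{h-1}$
remaining conditions, precisely because $m_0<\sharp\Xi_{h-2}$ (`exists_combination`).

The partial derivatives involved are constant along the trajectory (`IsTrajectory.pd_eq`), so the
same coefficients `γ` work at all its points. The combination of linearized equations is then $\sum
b_v\,dx_v'=(d/d\tau)\sum b_v\,dx_v$ with constant $b_v$. The separants make the matrix of the
$\partial P/\partial x'$ block diagonal with invertible blocks. Hence $b\ne0$, and the linearized
relations contain no nonzero form of order zero, so $\sum b_v\,dx_v$ is a nonzero torsion element.

For non-flatness, let $f=\sum b_vx_v$. Along the trajectory the differential of $d_tf$ vanishes on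
the diffiety. In flat coordinates, $[\partial_{z^{(k+1)}},d_t]=\partial_{z^{(k)}}$ and a descending
induction on $k$ show that $df$ is there a multiple of $dt$ (`lineDeriv_jetBasis_eq_zero`). But the
implicit function theorem yields a curve in the diffiety through `η`, with time fixed and $x$ moving
in the direction $b$, along which $f$ has derivative $\sum b_v^2\neq0$ (`exists_transverse_curve`).

The jet space carries no norm: differentials are tested along curves, coordinate by coordinate, and
smooth functions are handled through truncations. -/

noncomputable section

namespace FlatSing

open Filter Topology

/-! ### Differential calculus on the jet space along curves. -/

section JetCalculus

variable {ι κ : Type*}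

/-- The curve `c` in the jet space has, coordinate by coordinate, the velocity `c'` at `s`. -/
def HasJetDeriv (c : ℝ → Jet ι) (c' : Jet ι) (s : ℝ) : Prop :=
  HasDerivAt (fun r => (c r).1) c'.1 s ∧ ∀ k i, HasDerivAt (fun r => (c r).2 k i) (c'.2 k i) s

theorem HasJetDeriv.continuousAt {c : ℝ → Jet ι} {c' : Jet ι} {s : ℝ} (h : HasJetDeriv c c' s) :
    ContinuousAt c s :=
  ContinuousAt.prodMk h.1.continuousAt
    (continuousAt_pi.2 fun k => continuousAt_pi.2 fun i => (h.2 k i).continuousAt)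

theorem HasJetDeriv.eventually_mem {c : ℝ → Jet ι} {c' : Jet ι} {s : ℝ} (h : HasJetDeriv c c' s)
    {O : Set (Jet ι)} (hO : IsOpen O) (hs : c s ∈ O) : ∀ᶠ r in 𝓝 s, c r ∈ O :=
  h.continuousAt.eventually_mem (hO.mem_nhds hs)

theorem hasJetDeriv_line (q v : Jet ι) : HasJetDeriv (fun s : ℝ => q + s • v) v 0 := by
  refine ⟨?_, fun k i => ?_⟩
  · simpa using ((hasDerivAt_id (0 : ℝ)).mul_const v.1).const_add q.1
  · simpa using ((hasDerivAt_id (0 : ℝ)).mul_const (v.2 k i)).const_add (q.2 k i)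

/-- Completing a truncated jet by the higher coordinates of `q` is a continuous section through `q`.
Openness turns smoothness on `trunc N '' O` into genuine differentiability at its points. -/
theorem isOpenMap_trunc (N : ℕ) : IsOpenMap (trunc N : Jet ι → TruncJet ι N) := by
  intro O hO
  rw [isOpen_iff_mem_nhds]
  rintro _ ⟨q, hq, rfl⟩
  let ext : TruncJet ι N → Jet ι := fun r =>
    (r.1, fun k i => if h : k < N then r.2 ⟨k, h⟩ i else q.2 k i)
  have hc : Continuous ext := by
    refine continuous_fst.prodMk (continuous_pi fun k => continuous_pi fun i => ?_)
    by_cases h : k < N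
    · simp only [h, dite_true]; fun_prop
    · simp only [h, dite_false]; fun_prop
  have hq' : ext (trunc N q) = q := by
    refine Prod.ext rfl (funext fun k => funext fun i => ?_)
    by_cases h : k < N <;> simp [ext, trunc, h]
  refine Filter.mem_of_superset ((hO.preimage hc).mem_nhds (by simpa [hq'] using hq)) ?_
  intro r hr
  refine ⟨ext r, hr, Prod.ext rfl (funext fun k => funext fun i => ?_)⟩
  simp [ext, trunc]

theorem continuous_firstJet : Continuous (firstJet : Jet ι → FirstJet ι) := by
  unfold firstJet
  fun_prop

variable [Fintype ι] [Fintype κ]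

theorem HasJetDeriv.hasDerivAt_trunc {c : ℝ → Jet ι} {c' : Jet ι} {s : ℝ}
    (h : HasJetDeriv c c' s) (N : ℕ) :
    HasDerivAt (fun r => trunc N (c r)) (trunc N c') s :=
  h.1.prodMk (hasDerivAt_pi.2 fun k => hasDerivAt_pi.2 fun i => h.2 k i)

section Representative

variable {F : Jet ι → ℝ} {O : Set (Jet ι)} {N : ℕ} {g : TruncJet ι N → ℝ}

theorem contDiffAt_of_representative (hO : IsOpen O) (hg : ContDiffOn ℝ ∞ g (trunc N '' O))
    {q : Jet ι} (hq : q ∈ O) : ContDiffAt ℝ ∞ g (trunc N q) :=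
  hg.contDiffAt ((isOpenMap_trunc N O hO).mem_nhds ⟨q, hq, rfl⟩)

theorem hasDerivAt_comp_of_representative (hO : IsOpen O)
    (hg : ContDiffOn ℝ ∞ g (trunc N '' O)) (hF : ∀ q ∈ O, F q = g (trunc N q))
    {c : ℝ → Jet ι} {c' : Jet ι} {s : ℝ} (h : HasJetDeriv c c' s) (hs : c s ∈ O) :
    HasDerivAt (fun r => F (c r)) (fderiv ℝ g (trunc N (c s)) (trunc N c')) s := by
  have h1 := ((contDiffAt_of_representative hO hg hs).differentiableAt
    (by simp)).hasFDerivAt.comp_hasDerivAt s (h.hasDerivAt_trunc N)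
  refine h1.congr_of_eventuallyEq ?_
  filter_upwards [h.eventually_mem hO hs] with r hr
  exact hF _ hr

theorem lineDeriv_of_representative (hO : IsOpen O)
    (hg : ContDiffOn ℝ ∞ g (trunc N '' O)) (hF : ∀ q ∈ O, F q = g (trunc N q))
    {q : Jet ι} (hq : q ∈ O) (v : Jet ι) :
    lineDeriv ℝ F q v = fderiv ℝ g (trunc N q) (trunc N v) := by
  have := hasDerivAt_comp_of_representative hO hg hF (hasJetDeriv_line q v) (by simpa using hq)
  simp only [zero_smul, add_zero] at this
  exact this.deriv

end Representative

theorem IsSmoothOn.hasDerivAt_comp {F : Jet ι → ℝ} {O : Set (Jet ι)} (hF : IsSmoothOn F O)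
    (hO : IsOpen O) {c : ℝ → Jet ι} {c' : Jet ι} {s : ℝ} (h : HasJetDeriv c c' s) (hs : c s ∈ O) :
    HasDerivAt (fun r => F (c r)) (lineDeriv ℝ F (c s) c') s := by
  obtain ⟨N, g, hg, hFg⟩ := hF
  rw [lineDeriv_of_representative hO hg hFg hs]
  exact hasDerivAt_comp_of_representative hO hg hFg h hs

/-- Forgetting the coordinates of order `N`, as a continuous linear map. -/
def dropLast (N : ℕ) : TruncJet ι (N + 1) →L[ℝ] TruncJet ι N :=
  (ContinuousLinearMap.fst ℝ _ _).prod
    ((ContinuousLinearMap.pi fun k : Fin N => ContinuousLinearMap.proj k.castSucc).comp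
      (ContinuousLinearMap.snd ℝ _ _))

/-- The Cartan vector field on truncated jets. -/
def cartanTrunc (N : ℕ) (r : TruncJet ι (N + 1)) : TruncJet ι N := (1, fun k => r.2 k.succ)

theorem contDiff_cartanTrunc (N : ℕ) : ContDiff ℝ ∞ (cartanTrunc N (ι := ι)) := by
  unfold cartanTrunc
  fun_prop

/-- The Cartan field shifts orders by one, so the derivative of a function of the coordinates of
order below `N` needs those of order `N` as well. -/
theorem IsSmoothOn.totalDeriv {F : Jet ι → ℝ} {O : Set (Jet ι)} (hF : IsSmoothOn F O)
    (hO : IsOpen O) : IsSmoothOn (totalDeriv F) O := by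
  obtain ⟨N, g, hg, hFg⟩ := hF
  refine ⟨N + 1, fun r => fderiv ℝ g (dropLast N r) (cartanTrunc N r), ?_, fun q hq =>
    lineDeriv_of_representative hO hg hFg hq _⟩
  have h1 : ContDiffOn ℝ ∞ (fderiv ℝ g) (trunc N '' O) :=
    hg.fderiv_of_isOpen (isOpenMap_trunc N O hO) (by simp)
  refine (h1.comp (dropLast N).contDiff.contDiffOn ?_).clm_apply
    (contDiff_cartanTrunc N).contDiffOn
  rintro _ ⟨q, hq, rfl⟩
  exact ⟨q, hq, rfl⟩

theorem IsSmoothOn.totalDeriv_iterate {F : Jet ι → ℝ} {O : Set (Jet ι)} (hF : IsSmoothOn F O)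
    (hO : IsOpen O) (k : ℕ) : IsSmoothOn (FlatSing.totalDeriv^[k] F) O := by
  induction k with
  | zero => exact hF
  | succ k ih => rw [Function.iterate_succ_apply']; exact ih.totalDeriv hO

theorem isSmoothOn_comp_firstJet {f : FirstJet ι → ℝ} {U : Set (FirstJet ι)}
    (hf : ContDiffOn ℝ ∞ f U) :
    IsSmoothOn (fun q => f (firstJet q)) (firstJet ⁻¹' U) := by
  refine ⟨2, fun r => f r.2, hf.comp contDiff_snd.contDiffOn ?_, fun q _ => rfl⟩
  rintro _ ⟨q, hq, rfl⟩
  exact hq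

theorem HasJetDeriv.hasDerivAt_firstJet {c : ℝ → Jet ι} {c' : Jet ι} {s : ℝ}
    (h : HasJetDeriv c c' s) : HasDerivAt (fun r => firstJet (c r)) (firstJet c') s :=
  hasDerivAt_pi.2 fun k => hasDerivAt_pi.2 fun i => h.2 k i

theorem IsSmoothOn.of_le {F : Jet ι → ℝ} {O : Set (Jet ι)} {N M : ℕ} (hNM : N ≤ M)
    {g : TruncJet ι N → ℝ} (hg : ContDiffOn ℝ ∞ g (trunc N '' O))
    (hF : ∀ q ∈ O, F q = g (trunc N q)) :
    ∃ g' : TruncJet ι M → ℝ, ContDiffOn ℝ ∞ g' (trunc M '' O) ∧ ∀ q ∈ O, F q = g' (trunc M q) := by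
  let ρ : TruncJet ι M → TruncJet ι N := fun r => (r.1, fun k => r.2 (Fin.castLE hNM k))
  refine ⟨g ∘ ρ, hg.comp (by fun_prop : ContDiff ℝ ∞ ρ).contDiffOn ?_, hF⟩
  rintro _ ⟨q, hq, rfl⟩
  exact ⟨q, hq, rfl⟩

theorem isSmoothOn_zero (O : Set (Jet ι)) : IsSmoothOn (fun _ => 0) O :=
  ⟨0, fun _ => 0, contDiffOn_const, fun _ _ => rfl⟩

theorem IsSmoothOn.add {F G : Jet ι → ℝ} {O : Set (Jet ι)} (hF : IsSmoothOn F O)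
    (hG : IsSmoothOn G O) : IsSmoothOn (fun q => F q + G q) O := by
  obtain ⟨N, f, hf, hFf⟩ := hF
  obtain ⟨M, g, hg, hGg⟩ := hG
  obtain ⟨f', hf', hFf'⟩ := IsSmoothOn.of_le (le_max_left N M) hf hFf
  obtain ⟨g', hg', hGg'⟩ := IsSmoothOn.of_le (le_max_right N M) hg hGg
  exact ⟨max N M, fun r => f' r + g' r, hf'.add hg', fun q hq => by
    simp only [hFf' q hq, hGg' q hq]⟩

theorem IsSmoothOn.const_mul {F : Jet ι → ℝ} {O : Set (Jet ι)} (a : ℝ) (hF : IsSmoothOn F O) :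
    IsSmoothOn (fun q => a * F q) O := by
  obtain ⟨N, f, hf, hFf⟩ := hF
  exact ⟨N, fun r => a * f r, contDiffOn_const.mul hf, fun q hq => by simp only [hFf q hq]⟩

theorem IsSmoothOn.linearCombination {α : Type*} (s : Finset α) (a : α → ℝ)
    {F : α → Jet ι → ℝ} {O : Set (Jet ι)} (hF : ∀ i, IsSmoothOn (F i) O) :
    IsSmoothOn (fun q => ∑ i ∈ s, a i * F i q) O := by
  classical
  induction s using Finset.induction_on with
  | empty => simpa using isSmoothOn_zero O
  | insert i s hi ih =>
    simp only [Finset.sum_insert hi]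
    exact ((hF i).const_mul (a i)).add ih

theorem IsSmoothOn.hasDerivAt_line {F : Jet ι → ℝ} {O : Set (Jet ι)} (hF : IsSmoothOn F O)
    (hO : IsOpen O) {q : Jet ι} (hq : q ∈ O) (v : Jet ι) :
    HasDerivAt (fun s : ℝ => F (q + s • v)) (lineDeriv ℝ F q v) 0 := by
  have h := hF.hasDerivAt_comp hO (hasJetDeriv_line q v) (by simpa using hq)
  simpa using h

theorem HasCartanDeriv.linearCombination {α : Type*} (s : Finset α) (a : α → ℝ)
    {X O : Set (Jet ι)} (hO : IsOpen O) {f f' : α → Jet ι → ℝ}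
    (hf : ∀ i, HasCartanDeriv X O (f i) (f' i)) :
    HasCartanDeriv X O (fun q => ∑ i ∈ s, a i * f i q) (fun q => ∑ i ∈ s, a i * f' i q) := by
  choose F hF hfF hfF' using hf
  refine ⟨fun q => ∑ i ∈ s, a i * F i q, IsSmoothOn.linearCombination s a hF, fun q hq => ?_,
    fun q hq => ?_⟩
  · exact Finset.sum_congr rfl fun i _ => by rw [hfF i q hq]
  · have h : HasDerivAt (fun r : ℝ => ∑ i ∈ s, a i * F i (q + r • cartan q))
        (∑ i ∈ s, a i * FlatSing.totalDeriv (F i) q) 0 :=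
      HasDerivAt.fun_sum fun i _ => ((hF i).hasDerivAt_line hO hq.2 (cartan q)).const_mul (a i)
    refine Eq.trans ?_ h.deriv.symm
    exact Finset.sum_congr rfl fun i _ => by rw [hfF' i q hq]

/-- Along a curve contained in `X ∩ O`, a function on `X ∩ O` is differentiable. -/
theorem HasCartanDeriv.exists_hasDerivAt {X O : Set (Jet ι)} {f f' : Jet ι → ℝ}
    (hf : HasCartanDeriv X O f f') (hO : IsOpen O) {c : ℝ → Jet ι} {c' : Jet ι} {s : ℝ}
    (h : HasJetDeriv c c' s) (hs : c s ∈ O) (hX : ∀ᶠ r in 𝓝 s, c r ∈ X) :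
    ∃ d, HasDerivAt (fun r => f (c r)) d s := by
  obtain ⟨F, hF, hfF, -⟩ := hf
  refine ⟨_, (hF.hasDerivAt_comp hO h hs).congr_of_eventuallyEq ?_⟩
  filter_upwards [hX, h.eventually_mem hO hs] with r hr hr'
  exact hfF _ ⟨hr, hr'⟩

/-- Along a curve contained in `X ∩ O` and tangent to the Cartan field, the derivative of a
function is its Cartan derivative. -/
theorem HasCartanDeriv.hasDerivAt {X O : Set (Jet ι)} {f f' : Jet ι → ℝ}
    (hf : HasCartanDeriv X O f f') (hO : IsOpen O) {c : ℝ → Jet ι} {s : ℝ}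
    (h : HasJetDeriv c (cartan (c s)) s) (hs : c s ∈ O) (hX : ∀ᶠ r in 𝓝 s, c r ∈ X) :
    HasDerivAt (fun r => f (c r)) (f' (c s)) s := by
  obtain ⟨F, hF, hfF, hfF'⟩ := hf
  rw [hfF' _ ⟨hX.self_of_nhds, hs⟩]
  refine (hF.hasDerivAt_comp hO h hs).congr_of_eventuallyEq ?_
  filter_upwards [hX, h.eventually_mem hO hs] with r hr hr'
  exact hfF _ ⟨hr, hr'⟩

/-- The direction of the coordinate `x_j^{(k)}`. -/
def jetBasis [DecidableEq κ] (k : ℕ) (j : κ) : Jet κ := (0, Pi.single k (Pi.single j 1))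

/-- If, along a curve tangent to the Cartan field, the Cartan derivative of `G` has vanishing
partial derivatives in all the `x_j^{(k)}`, then so has `G`. -/
theorem lineDeriv_jetBasis_eq_zero [DecidableEq κ] {O : Set (Jet κ)} (hO : IsOpen O)
    {G : Jet κ → ℝ} (hG : IsSmoothOn G O) {J : Set ℝ} (hJ : IsOpen J) {ζ : ℝ → Jet κ}
    (hζO : ∀ t ∈ J, ζ t ∈ O) (hζ : ∀ t ∈ J, HasJetDeriv ζ (cartan (ζ t)) t)
    (hδ : ∀ t ∈ J, ∀ k j, lineDeriv ℝ (totalDeriv G) (ζ t) (jetBasis k j) = 0) :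
    ∀ k j, ∀ t ∈ J, lineDeriv ℝ G (ζ t) (jetBasis k j) = 0 := by
  obtain ⟨N, g, hg, hGg⟩ := hG
  have hU := isOpenMap_trunc N O hO
  have hdg : ContDiffOn ℝ ∞ (fderiv ℝ g) (trunc N '' O) := hg.fderiv_of_isOpen hU (by simp)
  have hlin : ∀ t ∈ J, ∀ v, lineDeriv ℝ G (ζ t) v = fderiv ℝ g (trunc N (ζ t)) (trunc N v) :=
    fun t ht v => lineDeriv_of_representative hO hg hGg (hζO t ht) v
  have hd2 : ∀ t ∈ J, HasFDerivAt (fderiv ℝ g) (fderiv ℝ (fderiv ℝ g) (trunc N (ζ t)))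
      (trunc N (ζ t)) := fun t ht =>
    ((hdg.contDiffAt (hU.mem_nhds ⟨_, hζO t ht, rfl⟩)).differentiableAt (by simp)).hasFDerivAt
  -- Differentiating `totalDeriv G` in the direction `e` gives two terms: a second derivative of
  -- `g`, and `dg` applied to the derivative of the Cartan field, which is `e` shifted down by one
  -- order.
  have key : ∀ t ∈ J, ∀ k j,
      fderiv ℝ (fderiv ℝ g) (trunc N (ζ t)) (trunc N (cartan (ζ t))) (trunc N (jetBasis k j)) +
      fderiv ℝ g (trunc N (ζ t)) (trunc N ((0, fun l => (jetBasis k j).2 (l + 1)) : Jet κ)) = 0 := by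
    intro t ht k j
    set e : Jet κ := jetBasis k j
    have h1 := hasJetDeriv_line (ζ t) e
    have h2 : HasDerivAt (fun s : ℝ => fderiv ℝ g (trunc N (ζ t + s • e)))
        (fderiv ℝ (fderiv ℝ g) (trunc N (ζ t)) (trunc N e)) 0 := by
      have h3 := hd2 t ht
      have h4 : ζ t = ζ t + (0 : ℝ) • e := by simp
      have h5 : HasFDerivAt (fderiv ℝ g) (fderiv ℝ (fderiv ℝ g) (trunc N (ζ t)))
        (trunc N (ζ t + (0 : ℝ) • e)) := by rw [← h4]; exact h3
      exact h5.comp_hasDerivAt 0 (h1.hasDerivAt_trunc N)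
    have h6 : HasJetDeriv (fun s : ℝ => cartan (ζ t + s • e)) (0, fun l => e.2 (l + 1)) 0 :=
      ⟨hasDerivAt_const _ _, fun l i => h1.2 (l + 1) i⟩
    have h7 := h2.clm_apply (h6.hasDerivAt_trunc N)
    have h8 := h7.congr_of_eventuallyEq (f₁ := fun s : ℝ => totalDeriv G (ζ t + s • e)) (by
      filter_upwards [h1.eventually_mem hO (by simpa using hζO t ht)] with s hs
      exact lineDeriv_of_representative hO hg hGg hs _)
    have h9 := h8.deriv.symm.trans (hδ t ht k j)
    simp only [zero_smul, add_zero] at h9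
    have hsymm : IsSymmSndFDerivAt ℝ g (trunc N (ζ t)) :=
      (contDiffAt_of_representative hO hg (hζO t ht)).isSymmSndFDerivAt
        (by rw [minSmoothness_of_isRCLikeNormedField]; exact ENat.LEInfty.out)
    rw [hsymm.eq]
    exact h9
  have hshift : ∀ k j, ((0, fun l => (jetBasis (k + 1) j).2 (l + 1)) : Jet κ) = jetBasis k j := by
    intro k j
    refine Prod.ext rfl (funext fun l => ?_)
    rcases eq_or_ne l k with rfl | h
    · simp [jetBasis]
    · simp [jetBasis, Pi.single_eq_of_ne h, Pi.single_eq_of_ne (show l + 1 ≠ k + 1 by omega)]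
  have hbig : ∀ k, N ≤ k → ∀ j : κ, trunc N (jetBasis k j) = 0 := by
    intro k hk j
    refine Prod.ext rfl (funext fun l => funext fun i => ?_)
    simp [trunc, jetBasis, Pi.single_eq_of_ne (show (l : ℕ) ≠ k by omega)]
  -- The second-derivative term in `key` is the time derivative of the partial of order `k + 1`
  -- along `ζ`. That partial vanishes on all of `J`, so the partial of order `k` vanishes too.
  have step : ∀ k j, (∀ t ∈ J, lineDeriv ℝ G (ζ t) (jetBasis (k + 1) j) = 0) →
      ∀ t ∈ J, lineDeriv ℝ G (ζ t) (jetBasis k j) = 0 := by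
    intro k j hk t ht
    have h1 : HasDerivAt (fun r => fderiv ℝ g (trunc N (ζ r)) (trunc N (jetBasis (k + 1) j)))
        (fderiv ℝ (fderiv ℝ g) (trunc N (ζ t)) (trunc N (cartan (ζ t)))
          (trunc N (jetBasis (k + 1) j))) t := by
      have h2 : HasDerivAt (fun r => fderiv ℝ g (trunc N (ζ r)))
          (fderiv ℝ (fderiv ℝ g) (trunc N (ζ t)) (trunc N (cartan (ζ t)))) t :=
        HasFDerivAt.comp_hasDerivAt (f := fun r => trunc N (ζ r)) t (hd2 t ht)
          ((hζ t ht).hasDerivAt_trunc N)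
      have h3 := h2.clm_apply (hasDerivAt_const t (trunc N (jetBasis (k + 1) j)))
      rwa [map_zero, add_zero] at h3
    have h3 : HasDerivAt (fun r => fderiv ℝ g (trunc N (ζ r)) (trunc N (jetBasis (k + 1) j)))
        0 t := by
      refine (hasDerivAt_const t (0 : ℝ)).congr_of_eventuallyEq ?_
      filter_upwards [hJ.mem_nhds ht] with r hr
      rw [← hlin r hr, hk r hr]
    have h4 := key t ht (k + 1) j
    rw [h1.unique h3, zero_add, hshift] at h4
    rw [hlin t ht, h4]
  intro k j
  -- Descending induction on `k`, starting from orders at least `N`, on which `g` does not depend.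
  have : ∀ n k, N ≤ k + n → ∀ t ∈ J, lineDeriv ℝ G (ζ t) (jetBasis k j) = 0 := by
    intro n
    induction n with
    | zero =>
      intro k hk t ht
      rw [hlin t ht, hbig k hk, map_zero]
    | succ n ih => exact fun k hk => step k j (ih (k + 1) (by omega))
  exact this N k (by omega)

/-- Only finitely many coordinates matter, so the differential is a finite combination of coordinate
differentials, and only its `dt` term survives. -/
theorem lineDeriv_eq_of_jetBasis_eq_zero [DecidableEq κ] {O : Set (Jet κ)} (hO : IsOpen O)
    {G : Jet κ → ℝ} (hG : IsSmoothOn G O) {ζ : Jet κ} (hζ : ζ ∈ O)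
    (h : ∀ k j, lineDeriv ℝ G ζ (jetBasis k j) = 0) (v : Jet κ) :
    lineDeriv ℝ G ζ v = v.1 * lineDeriv ℝ G ζ (1, 0) := by
  obtain ⟨N, g, hg, hGg⟩ := hG
  have hlin := lineDeriv_of_representative hO hg hGg hζ
  simp only [hlin] at h ⊢
  have hv : trunc N v = v.1 • trunc N ((1, 0) : Jet κ) +
      ∑ k : Fin N, ∑ j : κ, v.2 k j • trunc N (jetBasis k j) := by
    refine Prod.ext ?_ (funext fun l => funext fun i => ?_)
    · simp [trunc, jetBasis, Prod.fst_sum]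
    · simp [trunc, jetBasis, Prod.snd_sum, Finset.sum_apply, Pi.single_apply, ite_apply,
        Fin.val_inj]
  rw [hv, map_add, map_smul, map_sum]
  simp [map_sum, h]

end JetCalculus

/-! ### An obstruction to flatness. -/

section NotFlat

variable {ι : Type*} [Fintype ι]

/-- The differential of `f = ∑ a_i x_i` on `X` vanishes at a flat point `η` in the directions
that preserve the time, as soon as `η` lies on a trajectory along which the differential of the
Cartan derivative of `f` vanishes on `X`. -/
theorem not_isFlatAt_of_deriv_eq_zero {X : Set (Jet ι)} {η : Jet ι} {J : Set ℝ} (hJ : IsOpen J)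
    {t₀ : ℝ} (ht₀ : t₀ ∈ J) {c : ℝ → Jet ι} (hcη : c t₀ = η) (hcX : ∀ t ∈ J, c t ∈ X)
    (hc : ∀ t ∈ J, HasJetDeriv c (cartan (c t)) t) (a : ι → ℝ)
    (ha : ∀ t ∈ J, ∀ (r : ℝ → Jet ι) (w : FirstJet ι), r 0 = c t → (∀ᶠ s in 𝓝 0, r s ∈ X) →
      HasDerivAt (fun s => firstJet (r s)) w 0 → ∑ i, a i * w 1 i = 0)
    {q : ℝ → Jet ι} {q' : Jet ι} (hq : HasJetDeriv q q' 0) (hqη : q 0 = η)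
    (hqX : ∀ᶠ s in 𝓝 0, q s ∈ X) (hqt : q'.1 = 0) (hqa : ∑ i, a i * q'.2 0 i ≠ 0) :
    ¬ IsFlatAt X η := by
  rintro ⟨-, m, O, O', φ, ψ, hO, hηO, hO', hφ, hψ, hψφ, hφψ, hφm, hψm⟩
  have hX' : ∀ {r : ℝ → Jet (Fin m)}, ∀ᶠ s in 𝓝 (0 : ℝ), r s ∈ (Set.univ : Set (Jet (Fin m))) :=
    Eventually.of_forall fun _ => Set.mem_univ _
  -- the image of the trajectory
  obtain ⟨K, hKJO, hK, htK⟩ : ∃ K ⊆ {t | t ∈ J ∧ c t ∈ O}, IsOpen K ∧ t₀ ∈ K := by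
    have h1 : ∀ᶠ t in 𝓝 t₀, t ∈ J ∧ c t ∈ O :=
      (hJ.eventually_mem ht₀).and ((hc t₀ ht₀).eventually_mem hO (hcη ▸ hηO))
    exact mem_nhds_iff.1 h1
  have hζO : ∀ t ∈ K, φ (c t) ∈ O' := fun t ht => hφ ⟨hcX t (hKJO ht).1, (hKJO ht).2⟩
  have hζ : ∀ t ∈ K, HasJetDeriv (fun r => φ (c r)) (cartan (φ (c t))) t := by
    intro t ht
    have hX : ∀ᶠ r in 𝓝 t, c r ∈ X := by
      filter_upwards [hK.mem_nhds ht] with r hr using hcX r (hKJO hr).1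
    exact ⟨hφm.1.hasDerivAt hO (hc t (hKJO ht).1) (hKJO ht).2 hX,
      fun k j => (hφm.2 k j).hasDerivAt hO (hc t (hKJO ht).1) (hKJO ht).2 hX⟩
  -- the image of the transverse curve
  have hq0O : q 0 ∈ O := hqη ▸ hηO
  obtain ⟨b', hb', hb0⟩ : ∃ b' : Jet (Fin m), HasJetDeriv (fun s => φ (q s)) b' 0 ∧
      φ (q 0) = φ (c t₀) := by
    obtain ⟨d, hd⟩ := hφm.1.exists_hasDerivAt hO hq hq0O hqX
    choose e he using fun k j => (hφm.2 k j).exists_hasDerivAt hO hq hq0O hqX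
    exact ⟨(d, e), ⟨hd, he⟩, by rw [hqη, hcη]⟩
  have hψφq : ∀ᶠ s in 𝓝 0, ψ (φ (q s)) = q s := by
    filter_upwards [hqX, hq.eventually_mem hO hq0O] with s h1 h2 using hψφ ⟨h1, h2⟩
  have hφqO' : φ (q 0) ∈ O' := hb0 ▸ hζO t₀ htK
  -- a function whose Cartan derivative has vanishing differential along the curve
  have main : ∀ f f' : Jet (Fin m) → ℝ, HasCartanDeriv Set.univ O' f f' →
      (∀ t ∈ K, ∀ k j, HasDerivAt (fun s : ℝ => f' (φ (c t) + s • jetBasis k j)) 0 0) →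
      ∃ κ : ℝ, (f' (φ (c t₀)) = κ) ∧ HasDerivAt (fun s => f (φ (q s))) (b'.1 * κ) 0 := by
    rintro f f' ⟨F, hF, hfF, hfF'⟩ hf'
    have hδ : ∀ t ∈ K, ∀ k j, lineDeriv ℝ (totalDeriv F) (φ (c t)) (jetBasis k j) = 0 := by
      intro t ht k j
      refine ((hf' t ht k j).congr_of_eventuallyEq ?_).deriv
      filter_upwards [(hasJetDeriv_line (φ (c t)) (jetBasis k j)).eventually_mem hO'
        (by simpa using hζO t ht)] with s hs using (hfF' _ ⟨Set.mem_univ _, hs⟩).symm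
    have h0 := fun k j => lineDeriv_jetBasis_eq_zero hO' hF hK hζO hζ hδ k j t₀ htK
    have h1 := lineDeriv_eq_of_jetBasis_eq_zero hO' hF (hζO t₀ htK) h0
    refine ⟨lineDeriv ℝ F (φ (c t₀)) (1, 0), ?_, ?_⟩
    · rw [hfF' _ ⟨Set.mem_univ _, hζO t₀ htK⟩]
      exact (h1 (cartan (φ (c t₀)))).trans (one_mul _)
    · rw [← h1, ← hb0]
      refine (hF.hasDerivAt_comp hO' hb' hφqO').congr_of_eventuallyEq ?_
      filter_upwards [hb'.eventually_mem hO' hφqO'] with s hs using hfF _ ⟨Set.mem_univ _, hs⟩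
  -- the time
  have htime : b'.1 = 0 := by
    obtain ⟨κ, hκ, h⟩ := main _ _ hψm.1 fun t _ k j => hasDerivAt_const _ _
    have h2 : HasDerivAt (fun s => (ψ (φ (q s))).1) 0 0 := by
      refine (hqt ▸ hq.1).congr_of_eventuallyEq ?_
      filter_upwards [hψφq] with s hs using by rw [hs]
    -- The Cartan derivative of time is `1`, so `κ = 1`: the image of `q` also preserves time
    -- infinitesimally.
    rw [← hκ, mul_one] at h
    exact h.unique h2
  -- the function `f`
  obtain ⟨κ, -, h⟩ := main _ _
    (HasCartanDeriv.linearCombination Finset.univ a hO' fun i => hψm.2 0 i) (by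
      intro t ht k j
      have hr := hasJetDeriv_line (φ (c t)) (jetBasis k j)
      have hr0 : φ (c t) + (0 : ℝ) • jetBasis k j ∈ O' := by simpa using hζO t ht
      choose w hw using fun (l : ℕ) i => (hψm.2 l i).exists_hasDerivAt hO' hr hr0 hX'
      have hw' : HasDerivAt (fun s : ℝ => firstJet (ψ (φ (c t) + s • jetBasis k j)))
          (fun l i => w l i) 0 :=
        hasDerivAt_pi.2 fun l => hasDerivAt_pi.2 fun i => hw l i
      -- A coordinate line in flat coordinates is sent by `ψ` to a curve of `X` through `c t`, to
      -- which the hypothesis on `X` applies.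
      have h0 := ha t (hKJO ht).1 _ _
        (by simpa using hψφ ⟨hcX t (hKJO ht).1, (hKJO ht).2⟩)
        (by filter_upwards [hr.eventually_mem hO' hr0] with s hs using (hψ hs).1) hw'
      have h1 : HasDerivAt (fun s : ℝ => ∑ i, a i * (ψ (φ (c t) + s • jetBasis k j)).2 1 i)
          (∑ i, a i * w 1 i) 0 := HasDerivAt.fun_sum fun i _ => (hw 1 i).const_mul (a i)
      exact h1.congr_deriv h0)
  have h2 : HasDerivAt (fun s => ∑ i, a i * (ψ (φ (q s))).2 0 i) (∑ i, a i * q'.2 0 i) 0 := by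
    have h3 : HasDerivAt (fun s => ∑ i, a i * (q s).2 0 i) (∑ i, a i * q'.2 0 i) 0 :=
      HasDerivAt.fun_sum fun i _ => (hq.2 0 i).const_mul (a i)
    refine h3.congr_of_eventuallyEq ?_
    filter_upwards [hψφq] with s hs using by rw [hs]
  rw [htime, zero_mul] at h
  exact hqa (h2.unique h)

end NotFlat

/-! ### Subsets invariant under the Cartan field, and trajectories. -/

section Trajectories

variable {V E : Type*} [Fintype V]

/-- Through each point of `A` passes a curve of `A` that is tangent there to the Cartan field. -/
def IsCartanInvariant (A : Set (Jet V)) : Prop :=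
  ∀ q ∈ A, ∃ (c : ℝ → Jet V) (s : ℝ), c s = q ∧ (∀ᶠ r in 𝓝 s, c r ∈ A) ∧
    HasJetDeriv c (cartan q) s

/-- If `F` vanishes on `A`, it vanishes along a curve of `A` tangent to the Cartan field, hence so
does its Cartan derivative; then iterate. No manifold structure on `A` is needed. -/
theorem IsCartanInvariant.totalDeriv_iterate_eq_zero {A O : Set (Jet V)}
    (hA : IsCartanInvariant A) (hO : IsOpen O) (hAO : A ⊆ O) {F : Jet V → ℝ}
    (hF : IsSmoothOn F O) (h0 : ∀ q ∈ A, F q = 0) (k : ℕ) :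
    ∀ q ∈ A, totalDeriv^[k] F q = 0 := by
  induction k with
  | zero => exact h0
  | succ k ih =>
    intro q hq
    obtain ⟨c, s, rfl, hcA, hc⟩ := hA q hq
    rw [Function.iterate_succ_apply']
    refine ((hF.totalDeriv_iterate hO k).hasDerivAt_comp hO hc (hAO hq)).unique ?_
    refine (hasDerivAt_const s (0 : ℝ)).congr_of_eventuallyEq ?_
    filter_upwards [hcA] with r hr using ih _ hr

theorem DiffSystem.contDiffOn_P (S : DiffSystem V E) (e : E) : ContDiffOn ℝ ∞ (S.P e) S.dom :=
  (S.analytic e).contDiffOn S.isOpen_dom.uniqueDiffOn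

theorem DiffSystem.subset_diffiety_of_isCartanInvariant (S : DiffSystem V E) {A : Set (Jet V)}
    (hA : IsCartanInvariant A) (hdom : ∀ q ∈ A, firstJet q ∈ S.dom)
    (h0 : ∀ q ∈ A, ∀ e, S.P e (firstJet q) = 0) : A ⊆ S.diffiety := fun q hq =>
  ⟨hdom q hq, fun e k => hA.totalDeriv_iterate_eq_zero (S.isOpen_dom.preimage continuous_firstJet)
    hdom (isSmoothOn_comp_firstJet (S.contDiffOn_P e)) (fun r hr => h0 r hr e) k q hq⟩

theorem hasJetDeriv_curveJet {I : Set ℝ} (hI : IsOpen I) {x : ℝ → V → ℝ}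
    (hx : ContDiffOn ℝ ∞ x I) {t : ℝ} (ht : t ∈ I) :
    HasJetDeriv (curveJet x) (cartan (curveJet x t)) t := by
  refine ⟨hasDerivAt_id t, fun k i => ?_⟩
  have h1 := hx.differentiableOn_iteratedDerivWithin (m := k)
    (by exact_mod_cast WithTop.coe_lt_coe.2 (ENat.natCast_lt_top k)) hI.uniqueDiffOn
  have h2 : DifferentiableAt ℝ (iteratedDeriv k x) t :=
    ((h1 t ht).differentiableAt (hI.mem_nhds ht)).congr_of_eventuallyEq (by
      filter_upwards [hI.mem_nhds ht] with r hr using (iteratedDerivWithin_of_isOpen hI hr).symm)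
  have h3 := h2.hasDerivAt
  rw [← iteratedDeriv_succ] at h3
  exact hasDerivAt_pi.1 h3 i

theorem isCartanInvariant_curveJet {I : Set ℝ} (hI : IsOpen I) {x : ℝ → V → ℝ}
    (hx : ContDiffOn ℝ ∞ x I) : IsCartanInvariant (curveJet x '' I) := by
  rintro _ ⟨t, ht, rfl⟩
  refine ⟨curveJet x, t, rfl, ?_, hasJetDeriv_curveJet hI hx ht⟩
  filter_upwards [hI.mem_nhds ht] with r hr using ⟨r, hr, rfl⟩

theorem DiffSystem.IsTrajectory.curveJet_mem_diffiety {S : DiffSystem V E} {I : Set ℝ}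
    {x : ℝ → V → ℝ} (hx : S.IsTrajectory I x) {t : ℝ} (ht : t ∈ I) :
    curveJet x t ∈ S.diffiety := by
  refine S.subset_diffiety_of_isCartanInvariant (isCartanInvariant_curveJet hx.isOpen hx.smooth)
    ?_ ?_ ⟨t, ht, rfl⟩
  · rintro _ ⟨r, hr, rfl⟩
    exact hx.mem_dom r hr
  · rintro _ ⟨r, hr, rfl⟩ e
    exact hx.solution r hr e

/-- The Taylor series at a point of a trajectory of a function that is constant along it. -/
theorem DiffSystem.IsTrajectory.taylorSeries_eq_C {S : DiffSystem V E} {I : Set ℝ}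
    {x : ℝ → V → ℝ} (hx : S.IsTrajectory I x) {f : FirstJet V → ℝ} (hf : ContDiffOn ℝ ∞ f S.dom)
    {a : ℝ} (ha : ∀ t ∈ I, f (firstJet (curveJet x t)) = a) {t : ℝ} (ht : t ∈ I) :
    taylorSeries (curveJet x t) (fun q => f (firstJet q)) = PowerSeries.C a := by
  have hO := S.isOpen_dom.preimage (continuous_firstJet (ι := V))
  have hA := isCartanInvariant_curveJet hx.isOpen hx.smooth
  have hF := isSmoothOn_comp_firstJet hf
  have hAO : curveJet x '' I ⊆ firstJet ⁻¹' S.dom := by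
    rintro _ ⟨r, hr, rfl⟩
    exact hx.mem_dom r hr
  have h1 : ∀ q ∈ curveJet x '' I, totalDeriv (fun q => f (firstJet q)) q = 0 := by
    rintro _ ⟨r, hr, rfl⟩
    refine (hF.hasDerivAt_comp hO (hasJetDeriv_curveJet hx.isOpen hx.smooth hr)
      (hx.mem_dom r hr)).unique ?_
    refine (hasDerivAt_const r a).congr_of_eventuallyEq ?_
    filter_upwards [hx.isOpen.mem_nhds hr] with s hs using ha s hs
  ext k
  rw [taylorSeries, PowerSeries.coeff_mk]
  rcases k with _ | k
  · simp [ha t ht]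
  · rw [Function.iterate_succ_apply,
      hA.totalDeriv_iterate_eq_zero hO hAO (hF.totalDeriv hO) h1 k _ ⟨t, ht, rfl⟩]
    simp

end Trajectories

/-! ### Linear algebra of block matrices. -/

section Blocks

variable {V E R : Type*} [Fintype V] [CommRing R] [NoZeroDivisors R]
  {p : ℕ} {lv : V → ℕ} {le : E → ℕ} {M : E → V → R}

theorem sum_block {α : Type*} [Fintype α] {A : Type*} [AddCommMonoid A] (l : α → ℕ) (h : ℕ)
    (f : α → A) (hf : ∀ i, l i ≠ h → f i = 0) : ∑ i : Block l h, f i = ∑ i, f i := by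
  rw [← Finset.sum_subtype (Finset.univ.filter fun i => l i = h) (by simp) f]
  exact Finset.sum_subset (Finset.filter_subset _ _) fun i _ hi => hf i (by simpa using hi)

/-- Rows of level `h` meet only columns of level `h - 1`, in a nonsingular square block, so each
block of `c` vanishes separately. The ring is general because both `ℝ` and `ℝ⟦τ⟧` are needed. -/
theorem eq_zero_of_blocks_left [DecidableEq V] [Fintype E] (hle : ∀ e, 1 ≤ le e ∧ le e ≤ p)
    (hM : ∀ e x, lv x + 1 ≠ le e → M e x = 0)
    (hdet : ∀ h, 1 ≤ h → h ≤ p → ∃ σ : Block lv (h - 1) ≃ Block le h,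
      (Matrix.of fun i j : Block lv (h - 1) => M (σ i) j).det ≠ 0)
    {c : E → R} (hc : ∀ x, ∑ e, c e * M e x = 0) : c = 0 := by
  funext e
  obtain ⟨σ, hσ⟩ := hdet (le e) (hle e).1 (hle e).2
  have h1 : (fun i => c (σ i)) = 0 := by
    refine Matrix.eq_zero_of_vecMul_eq_zero hσ (funext fun j => ?_)
    have h2 := σ.sum_comp fun b => c b * M b j
    simp only [Matrix.vecMul, dotProduct, Matrix.of_apply, Pi.zero_apply]
    rw [h2, sum_block le (le e) (fun b => c b * M b j), hc]
    intro b hb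
    rw [hM b j, mul_zero]
    have := j.2; have := (hle e).1
    omega
  simpa using congrFun h1 (σ.symm ⟨e, rfl⟩)

/-- The same block argument on columns; the last block `p` is paired with no equations and stays
free. -/
theorem eq_zero_of_blocks_right [DecidableEq V] (hM : ∀ e x, lv x + 1 ≠ le e → M e x = 0)
    (hdet : ∀ h, 1 ≤ h → h ≤ p → ∃ σ : Block lv (h - 1) ≃ Block le h,
      (Matrix.of fun i j : Block lv (h - 1) => M (σ i) j).det ≠ 0)
    {y : V → R} (hy : ∀ e, ∑ x, M e x * y x = 0) {x : V} (hx : lv x < p) : y x = 0 := by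
  obtain ⟨σ, hσ⟩ := hdet (lv x + 1) (by omega) (by omega)
  have h1 : (fun j : Block lv (lv x + 1 - 1) => y j) = 0 := by
    refine Matrix.eq_zero_of_mulVec_eq_zero hσ (funext fun i => ?_)
    simp only [Matrix.mulVec, dotProduct, Matrix.of_apply, Pi.zero_apply]
    rw [sum_block lv (lv x + 1 - 1) (fun x => M (σ i) x * y x), hy]
    intro b hb
    rw [hM _ b, zero_mul]
    have := (σ i).2
    omega
  exact congrFun h1 ⟨x, rfl⟩

/-- This count makes the system for the velocities square once those of the last block are
prescribed. -/
theorem card_eq_of_blocks [Fintype E] (hle : ∀ e, 1 ≤ le e ∧ le e ≤ p) (hlv : ∀ x, lv x ≤ p)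
    (hσ : ∀ h, 1 ≤ h → h ≤ p → Nat.card (Block lv (h - 1)) = Nat.card (Block le h)) :
    Fintype.card E + Fintype.card (Block lv p) = Fintype.card V := by
  have hV := Finset.card_eq_sum_card_fiberwise (f := lv) (s := Finset.univ)
    (t := Finset.range (p + 1)) fun x _ => by simpa using Nat.lt_succ_of_le (hlv x)
  have hE := Finset.card_eq_sum_card_fiberwise (f := le) (s := Finset.univ)
    (t := (Finset.range p).map (addRightEmbedding 1)) fun e _ => by
      have := hle e
      simp only [Finset.coe_map, Set.mem_image, Finset.mem_coe, Finset.mem_range]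
      exact ⟨le e - 1, by omega, by simp; omega⟩
  rw [Finset.sum_map] at hE
  rw [Finset.sum_range_succ] at hV
  simp only [Finset.card_univ] at hV hE
  rw [hV, hE, Fintype.card_subtype]
  congr 1
  refine Finset.sum_congr rfl fun h hh => ?_
  have := hσ (h + 1) (by omega) (by simpa using hh)
  simp only [Nat.card_eq_fintype_card, Fintype.card_subtype, Nat.add_sub_cancel] at this
  rw [this]
  rfl

end Blocks

/-! ### Leading coefficients in the differential module. -/

section FormDeriv

variable {V : Type*}

theorem formDeriv_single (v : ℕ × V) (a : PowerSeries ℝ) :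
    formDeriv (Finsupp.single v a) =
      Finsupp.single v (PowerSeries.derivative ℝ a) + Finsupp.single (v.1 + 1, v.2) a := by
  rw [formDeriv, Finsupp.sum_single_index]
  simp

theorem formDeriv_add (w w' : Forms V) : formDeriv (w + w') = formDeriv w + formDeriv w' := by
  refine Finsupp.sum_add_index' (fun v => by simp) fun v a b => ?_
  simp only [map_add, Finsupp.single_add]
  abel

theorem formDeriv_sum {α : Type*} (s : Finset α) (w : α → Forms V) :
    formDeriv (∑ i ∈ s, w i) = ∑ i ∈ s, formDeriv (w i) :=
  map_sum (AddMonoidHom.mk' formDeriv formDeriv_add) w s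

theorem formDeriv_apply_succ (w : Forms V) (j : ℕ) (v : V) :
    formDeriv w (j + 1, v) = PowerSeries.derivative ℝ (w (j + 1, v)) + w (j, v) := by
  classical
  induction w using Finsupp.induction_linear with
  | zero => simp [formDeriv]
  | add w w' h h' =>
    rw [formDeriv_add, Finsupp.add_apply, h, h']
    simp only [Finsupp.add_apply, map_add]
    abel
  | single u a =>
    obtain ⟨k, u⟩ := u
    rw [formDeriv_single]
    simp only [Finsupp.add_apply, Finsupp.single_apply, Prod.mk.injEq, Nat.add_right_cancel_iff]
    split_ifs <;> simp

/-- Differentiating a coefficient does not raise the order, so each derivation moves the leading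
coefficients up one order unchanged. -/
theorem formDeriv_iterate_leading {w : Forms V} {u : V → PowerSeries ℝ}
    (h0 : ∀ j v, 1 < j → w (j, v) = 0) (h1 : ∀ v, w (1, v) = u v) (k : ℕ) :
    (∀ j v, k + 1 < j → (formDeriv^[k] w) (j, v) = 0) ∧
      ∀ v, (formDeriv^[k] w) (k + 1, v) = u v := by
  induction k with
  | zero => exact ⟨h0, h1⟩
  | succ k ih =>
    simp only [Function.iterate_succ_apply']
    refine ⟨fun j v hj => ?_, fun v => ?_⟩
    · obtain ⟨j, rfl⟩ : ∃ i, j = i + 1 := ⟨j - 1, by omega⟩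
      rw [formDeriv_apply_succ, ih.1 _ _ (by omega), ih.1 _ _ (by omega)]
      simp
    · rw [formDeriv_apply_succ, ih.1 _ _ (by omega), ih.2, map_zero, zero_add]

/-- The differential module generated by equations of order one whose leading coefficients are
independent contains no nonzero form of order zero. -/
theorem eq_zero_of_mem_span_of_order_zero {E : Type*} [Fintype E] {l : E → Forms V}
    (h0 : ∀ e j v, 1 < j → l e (j, v) = 0)
    (hinj : ∀ c : E → PowerSeries ℝ, (∀ v, ∑ e, c e * l e (1, v) = 0) → c = 0)
    {w : Forms V} (hw : ∀ j v, 0 < j → w (j, v) = 0)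
    (hmem : w ∈ Submodule.span (PowerSeries ℝ) {w | ∃ (e : E) (k : ℕ), w = formDeriv^[k] (l e)}) :
    w = 0 := by
  have hset : {w | ∃ (e : E) (k : ℕ), w = formDeriv^[k] (l e)} =
      Set.range fun i : E × ℕ => formDeriv^[i.2] (l i.1) := by
    ext w
    simp [eq_comm]
  rw [hset, Finsupp.mem_span_range_iff_exists_finsupp] at hmem
  obtain ⟨c, rfl⟩ := hmem
  suffices c = 0 by simp [this]
  by_contra hc
  obtain ⟨i, hi, hmax⟩ := Finset.exists_max_image c.support (fun i => i.2)
    (Finsupp.support_nonempty_iff.2 hc)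
  refine Finsupp.mem_support_iff.1 hi
    (congrFun (hinj (fun e => c (e, i.2)) fun v => ?_) i.1)
  -- With `i.2` the highest derivation order used, the terms of order `i.2 + 1` come only from it,
  -- and their coefficient is the combination of leading coefficients, which must vanish.
  rw [← hw (i.2 + 1) v (Nat.succ_pos _)]
  rw [Finsupp.sum_of_support_subset (s := Finset.univ ×ˢ Finset.range (i.2 + 1)) c
    (fun b hb => by simpa using Nat.lt_succ_of_le (hmax b hb)) _ (by simp),
    Finset.sum_product, Finsupp.finsetSum_apply]
  refine Finset.sum_congr rfl fun e _ => ?_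
  have hl := fun k => formDeriv_iterate_leading (h0 e) (fun v => rfl) k
  rw [Finset.sum_range_succ, Finsupp.add_apply, Finsupp.finsetSum_apply,
    Finset.sum_eq_zero fun k hk => ?_, zero_add, Finsupp.smul_apply, (hl i.2).2, smul_eq_mul]
  rw [Finsupp.smul_apply, (hl k).1 _ _ (by simpa using hk), smul_zero]

end FormDeriv

/-! ### Partial derivatives along a trajectory; eliminating the order-zero terms. -/

namespace DiffSystem

variable {V E : Type*} [Fintype V] [DecidableEq V] {S : DiffSystem V E}

theorem contDiffOn_pd (e : E) (k : Fin 2) (v : V) : ContDiffOn ℝ ∞ (S.pd e k v) S.dom :=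
  ((S.contDiffOn_P e).fderiv_of_isOpen S.isOpen_dom (by simp)).clm_apply contDiffOn_const

theorem firstJet_eq_sum (w : FirstJet V) :
    w = ∑ k : Fin 2, ∑ v : V, w k v • (Pi.single k (Pi.single v 1) : FirstJet V) := by
  funext k v
  simp [Finset.sum_apply, Pi.single_apply, ite_apply]

theorem fderiv_P_apply (e : E) (z w : FirstJet V) :
    fderiv ℝ (S.P e) z w = ∑ k, ∑ v, w k v * S.pd e k v z := by
  conv_lhs => rw [firstJet_eq_sum w]
  simp [map_sum, pd, -Fin.sum_univ_two]

theorem fderiv_pd_comm (e : E) (k l : Fin 2) (v u : V) {z : FirstJet V} (hz : z ∈ S.dom) :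
    fderiv ℝ (S.pd e k v) z (Pi.single l (Pi.single u 1)) =
      fderiv ℝ (S.pd e l u) z (Pi.single k (Pi.single v 1)) := by
  have hP : ContDiffAt ℝ ∞ (S.P e) z := (S.contDiffOn_P e).contDiffAt (S.isOpen_dom.mem_nhds hz)
  have hd : DifferentiableAt ℝ (fderiv ℝ (S.P e)) z :=
    (((S.contDiffOn_P e).fderiv_of_isOpen S.isOpen_dom (m := ∞) (by simp)).contDiffAt
      (S.isOpen_dom.mem_nhds hz)).differentiableAt (by simp)
  have h : ∀ (w w' : FirstJet V), fderiv ℝ (fun z => fderiv ℝ (S.P e) z w) z w' =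
      fderiv ℝ (fderiv ℝ (S.P e)) z w' w := by
    intro w w'
    rw [fderiv_clm_apply hd (differentiableAt_const w)]
    simp
  have hs : IsSymmSndFDerivAt ℝ (S.P e) z := hP.isSymmSndFDerivAt
    (by rw [minSmoothness_of_isRCLikeNormedField]; exact ENat.LEInfty.out)
  exact (h _ _).trans ((hs.eq _ _).trans (h _ _).symm)

/-- The partial derivatives of an equation are constant along a trajectory, if so are all the
quantities that appear nonlinearly in this equation. -/
theorem IsTrajectory.pd_eq {I : Set ℝ} {x : ℝ → V → ℝ} (hx : S.IsTrajectory I x) {e : E}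
    (he : ∀ k v, S.AppearsNonlinearly e k v → ∃ c : ℝ, ∀ t ∈ I, iteratedDeriv k x t v = c)
    (k : Fin 2) (v : V) {t s : ℝ} (ht : t ∈ I) (hs : s ∈ I) :
    S.pd e k v (firstJet (curveJet x t)) = S.pd e k v (firstJet (curveJet x s)) := by
  have hd : ∀ t ∈ I, HasDerivAt (fun t => S.pd e k v (firstJet (curveJet x t))) 0 t := by
    intro t ht
    have hz : firstJet (curveJet x t) ∈ S.dom := hx.mem_dom t ht
    have hc := hasJetDeriv_curveJet hx.isOpen hx.smooth ht
    have h1 : DifferentiableAt ℝ (S.pd e k v) (firstJet (curveJet x t)) :=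
      ((contDiffOn_pd e k v).contDiffAt (S.isOpen_dom.mem_nhds hz)).differentiableAt (by simp)
    have h2 := HasFDerivAt.comp_hasDerivAt (f := fun t => firstJet (curveJet x t)) t
      h1.hasFDerivAt hc.hasDerivAt_firstJet
    refine h2.congr_deriv ?_
    set w := firstJet (cartan (curveJet x t))
    rw [firstJet_eq_sum w]
    simp only [map_sum, map_smul]
    refine Finset.sum_eq_zero fun l _ => Finset.sum_eq_zero fun u _ => ?_
    -- Each term of the chain rule vanishes: either the quantity is constant in time, or
    -- `∂P/∂u^{(l)}` is constant and the mixed second derivative is zero by symmetry.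
    by_cases hl : S.AppearsNonlinearly e l u
    · obtain ⟨c, hc'⟩ := he l u hl
      have h3 : w l u = 0 := by
        refine (hc.2 l u).unique ((hasDerivAt_const t c).congr_of_eventuallyEq ?_)
        filter_upwards [hx.isOpen.mem_nhds ht] with r hr using hc' r hr
      rw [h3, zero_smul]
    · obtain ⟨a, ha⟩ := not_not.1 hl
      rw [fderiv_pd_comm e k l v u hz]
      have h3 : S.pd e l u =ᶠ[𝓝 (firstJet (curveJet x t))] fun _ => a := by
        filter_upwards [S.isOpen_dom.mem_nhds hz] with z hz using ha z hz
      rw [h3.fderiv_eq]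
      simp
  exact hx.isOpen.is_const_of_deriv_eq_zero hx.ordConnected.isPreconnected
    (fun t ht => (hd t ht).differentiableAt.differentiableWithinAt) (fun t ht => (hd t ht).deriv)
    ht hs

theorem pd_eq_zero_of_not_dependsOn {e : E} {k : Fin 2} {v : V} (h : ¬ S.DependsOn e k v)
    {z : FirstJet V} (hz : z ∈ S.dom) : S.pd e k v z = 0 := by
  by_contra h'
  exact h ⟨z, hz, h'⟩

theorem ord_ne_bot_of_dependsOn {e : E} {k : Fin 2} {v : V} (h : S.DependsOn e k v) :
    S.ord e v ≠ ⊥ := by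
  unfold ord
  split_ifs with h1 h0
  · exact WithBot.one_ne_bot
  · exact WithBot.zero_ne_bot
  · fin_cases k
    · exact absurd h h0
    · exact absurd h h1

variable [Fintype E] {p : ℕ} {lv : V → ℕ} {le : E → ℕ}

theorem IsBlockTriangular.pd_one_eq_zero (hS : S.IsBlockTriangular p lv le) {e : E} {v : V}
    (h : lv v + 1 ≠ le e) {z : FirstJet V} (hz : z ∈ S.dom) : S.pd e 1 v z = 0 := by
  refine pd_eq_zero_of_not_dependsOn (fun hd => ?_) hz
  have := hS.order_le e v h
  rw [ord, if_pos hd] at this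
  exact absurd this (by decide)

/-- Some nontrivial combination of the equations of levels `h - 1` and `h` has, at `η`, a
differential without terms of order zero. -/
theorem exists_combination (hS : S.IsBlockTriangular p lv le) {h : ℕ} (h_ge : 2 ≤ h)
    (h_le : h ≤ p) (hchained : S.IsChainedAt lv le h)
    (hstrict : S.IsStrictlyChainedAt lv le (h - 1)) {η : Jet V} (hη : firstJet η ∈ S.dom)
    (hrank : (S.jacobian lv le 0 h h η).rank < Nat.card (Block lv (h - 2))) :
    ∃ γ : E → ℝ, γ ≠ 0 ∧ (∀ e, le e ≠ h - 1 → le e ≠ h → γ e = 0) ∧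
      ∀ v, ∑ e, γ e * S.pd e 0 v (firstJet η) = 0 := by
  classical
  set B := S.jacobian lv le 0 h h η
  -- Null vectors of `B` already cancel the terms in `Ξ_h`; `Φ` records what remains in `Ξ_{h-1}`.
  let Φ : LinearMap.ker B.vecMulLinear × (Block le (h - 1) → ℝ) →ₗ[ℝ]
      (Block lv (h - 1) → ℝ) :=
    ((S.jacobian lv le 0 h (h - 1) η).vecMulLinear ∘ₗ (LinearMap.ker B.vecMulLinear).subtype).coprod
      (S.jacobian lv le 0 (h - 1) (h - 1) η).vecMulLinear
  have hker : Module.finrank ℝ (LinearMap.ker B.vecMulLinear) + B.rank =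
      Fintype.card (Block le h) := by
    have h1 := LinearMap.finrank_range_add_finrank_ker B.vecMulLinear
    have h2 : Module.finrank ℝ (LinearMap.range B.vecMulLinear) = B.rank := by
      rw [← Matrix.rank_transpose, Matrix.rank, Matrix.mulVecLin_transpose]
    rw [h2, Module.finrank_fintype_fun_eq_card] at h1
    omega
  have hc1 := hS.card_eq h (by omega) h_le
  have hc2 := hS.card_eq (h - 1) (by omega) (by omega)
  rw [show h - 1 - 1 = h - 2 by omega] at hc2
  -- The source has dimension `♯Σ_h - rank B + ♯Ξ_{h-2}`, which exceeds that of the target,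
  -- `♯Ξ_{h-1} = ♯Σ_h`.
  have hΦ : LinearMap.ker Φ ≠ ⊥ := by
    apply LinearMap.ker_ne_bot_of_finrank_lt
    rw [Module.finrank_prod, Module.finrank_fintype_fun_eq_card,
      Module.finrank_fintype_fun_eq_card]
    simp only [Nat.card_eq_fintype_card] at hc1 hc2 hrank
    omega
  obtain ⟨⟨⟨α, hα⟩, β⟩, hΦ0, hne⟩ := Submodule.exists_mem_ne_zero_of_ne_bot hΦ
  have hα' : Matrix.vecMul α B = 0 := hα
  have hΦ' : Matrix.vecMul α (S.jacobian lv le 0 h (h - 1) η) +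
      Matrix.vecMul β (S.jacobian lv le 0 (h - 1) (h - 1) η) = 0 := hΦ0
  let γ₁ : E → ℝ := fun e => if he : le e = h then α ⟨e, he⟩ else 0
  let γ₂ : E → ℝ := fun e => if he : le e = h - 1 then β ⟨e, he⟩ else 0
  have hγ₁ : ∀ j (v : Block lv j), ∑ e, γ₁ e * S.pd e 0 v (firstJet η) =
      Matrix.vecMul α (S.jacobian lv le 0 h j η) v := by
    intro j v
    rw [← sum_block le h _ fun e he => by simp [γ₁, he]]
    exact Finset.sum_congr rfl fun e _ => by simp [γ₁, e.2, jacobian]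
  have hγ₂ : ∀ j (v : Block lv j), ∑ e, γ₂ e * S.pd e 0 v (firstJet η) =
      Matrix.vecMul β (S.jacobian lv le 0 (h - 1) j η) v := by
    intro j v
    rw [← sum_block le (h - 1) _ fun e he => by simp [γ₂, he]]
    exact Finset.sum_congr rfl fun e _ => by simp [γ₂, e.2, jacobian]
  refine ⟨fun e => γ₁ e + γ₂ e, fun h0 => hne ?_, fun e h1 h2 => ?_, fun v => ?_⟩
  · have hα0 : α = 0 := funext fun e => by
      have := congrFun h0 e
      have he := e.2
      simpa [γ₁, γ₂, he, show h ≠ h - 1 by omega] using this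
    have hβ0 : β = 0 := funext fun e => by
      have := congrFun h0 e
      have he := e.2
      simpa [γ₁, γ₂, he, show h - 1 ≠ h by omega] using this
    subst hα0 hβ0
    rfl
  · simp [γ₁, γ₂, h1, h2]
  · simp only [add_mul, Finset.sum_add_distrib]
    by_cases hv : lv v = h - 1
    · rw [hγ₁ _ ⟨v, hv⟩, hγ₂ _ ⟨v, hv⟩]
      exact congrFun hΦ' ⟨v, hv⟩
    -- Strict chaining enters here: level `h - 1` contributes no order-zero terms outside `Ξ_{h-1}`,
    -- not even in `Ξ_{h-2}`.
    · have h2 : ∑ e, γ₂ e * S.pd e 0 v (firstJet η) = 0 := by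
        refine Finset.sum_eq_zero fun e _ => ?_
        by_cases he : le e = h - 1
        · rw [pd_eq_zero_of_not_dependsOn (fun hd => ?_) hη, mul_zero]
          rcases hstrict.1 e v he (ord_ne_bot_of_dependsOn hd) with h3 | h3
          · exact hv h3
          · exact hstrict.2 e v he h3 hd
        · simp [γ₂, he]
      rw [h2, add_zero]
      by_cases hv' : lv v = h
      · rw [hγ₁ _ ⟨v, hv'⟩]
        exact congrFun hα' ⟨v, hv'⟩
      · refine Finset.sum_eq_zero fun e _ => ?_
        by_cases he : le e = h
        · rw [pd_eq_zero_of_not_dependsOn (fun hd => ?_) hη, mul_zero]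
          have := hchained e v he (ord_ne_bot_of_dependsOn hd)
          omega
        · simp [γ₁, he]

end DiffSystem

/-! ### Jets of the integral curves of a time-dependent vector field. -/

section LieJet

variable {V : Type*} [Fintype V]

/-- The iterated Lie derivatives of the coordinates `ξ` along the vector field
`∂_t + y(t, ξ) ∂_ξ`. -/
def lieJet (y : ℝ × (V → ℝ) → V → ℝ) : ℕ → ℝ × (V → ℝ) → V → ℝ
  | 0 => Prod.snd
  | k + 1 => fun m => fderiv ℝ (lieJet y k) m (1, y m)

/-- The jets of the integral curves of the vector field `∂_t + y(t, ξ) ∂_ξ`. -/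
def lieSection (y : ℝ × (V → ℝ) → V → ℝ) (m : ℝ × (V → ℝ)) : Jet V := (m.1, fun k => lieJet y k m)

variable {y : ℝ × (V → ℝ) → V → ℝ} {W : Set (ℝ × (V → ℝ))}

theorem contDiffOn_lieJet (hW : IsOpen W) (hy : ContDiffOn ℝ ∞ y W) (k : ℕ) :
    ContDiffOn ℝ ∞ (lieJet y k) W := by
  induction k with
  | zero => exact contDiff_snd.contDiffOn
  | succ k ih => exact (ih.fderiv_of_isOpen hW (by simp)).clm_apply (contDiffOn_const.prodMk hy)

theorem lieJet_one (m : ℝ × (V → ℝ)) : lieJet y 1 m = y m := by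
  simp [lieJet, fderiv_snd]

theorem hasFDerivAt_lieJet (hW : IsOpen W) (hy : ContDiffOn ℝ ∞ y W) {m : ℝ × (V → ℝ)}
    (hm : m ∈ W) (k : ℕ) : HasFDerivAt (lieJet y k) (fderiv ℝ (lieJet y k) m) m :=
  (((contDiffOn_lieJet hW hy k).contDiffAt (hW.mem_nhds hm)).differentiableAt
    (by simp)).hasFDerivAt

theorem hasJetDeriv_lieSection (hW : IsOpen W) (hy : ContDiffOn ℝ ∞ y W) {c : ℝ → ℝ × (V → ℝ)}
    {c' : ℝ × (V → ℝ)} {s : ℝ} (hc : HasDerivAt c c' s) (hs : c s ∈ W) :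
    HasJetDeriv (fun r => lieSection y (c r)) (c'.1, fun k => fderiv ℝ (lieJet y k) (c s) c') s :=
  ⟨(ContinuousLinearMap.fst ℝ ℝ (V → ℝ)).hasFDerivAt.comp_hasDerivAt s hc, fun k i => hasDerivAt_pi.1
    ((hasFDerivAt_lieJet hW hy hs k).comp_hasDerivAt s hc) i⟩

/-- The section maps the straight line of direction `(1, y m)` to a curve whose velocity at `m` is
the Cartan field. Tangency suffices, so no differential equation has to be solved. -/
theorem isCartanInvariant_lieSection (hW : IsOpen W) (hy : ContDiffOn ℝ ∞ y W) :
    IsCartanInvariant (lieSection y '' W) := by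
  rintro _ ⟨m, hm, rfl⟩
  have hc : HasDerivAt (fun s : ℝ => m + s • ((1 : ℝ), y m)) (1, y m) 0 := by
    simpa using ((hasDerivAt_id (0 : ℝ)).smul_const ((1 : ℝ), y m)).const_add m
  have h0 : m + (0 : ℝ) • ((1 : ℝ), y m) = m := by simp
  refine ⟨fun s => lieSection y (m + s • ((1 : ℝ), y m)), 0, by simp only [h0], ?_, ?_⟩
  · filter_upwards [hc.continuousAt.eventually_mem (hW.mem_nhds (h0.symm ▸ hm))] with r hr
      using ⟨_, hr, rfl⟩
  · have h := hasJetDeriv_lieSection hW hy hc (h0.symm ▸ hm)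
    simp only [h0] at h
    exact h

/-- By the chain rule, Lie derivatives restrict along an integral curve to time derivatives. -/
theorem lieSection_eq_curveJet (hW : IsOpen W) (hy : ContDiffOn ℝ ∞ y W) {x : ℝ → V → ℝ}
    {K : Set ℝ} (hK : IsOpen K)
    (hx : ∀ t ∈ K, (t, x t) ∈ W ∧ HasDerivAt x (y (t, x t)) t) {t : ℝ} (ht : t ∈ K) :
    lieSection y (t, x t) = curveJet x t := by
  refine Prod.ext rfl (funext fun k => ?_)
  change lieJet y k (t, x t) = iteratedDeriv k x t
  induction k generalizing t with
  | zero => simp [lieJet]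
  | succ k ih =>
    rw [iteratedDeriv_succ]
    have h1 : HasDerivAt (fun t => lieJet y k (t, x t)) (lieJet y (k + 1) (t, x t)) t :=
      HasFDerivAt.comp_hasDerivAt (f := fun t => (t, x t)) t
        (hasFDerivAt_lieJet hW hy (hx t ht).1 k) ((hasDerivAt_id t).prodMk (hx t ht).2)
    refine (h1.congr_of_eventuallyEq ?_).deriv.symm
    filter_upwards [hK.mem_nhds ht] with r hr using (ih hr).symm

end LieJet

/-! ### Solving for the velocities; curves transverse to the trajectory. -/

namespace DiffSystem

variable {V E : Type*} [Fintype V] [DecidableEq V] [Fintype E] {S : DiffSystem V E}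
  {p : ℕ} {lv : V → ℕ} {le : E → ℕ}

/-- Near a point where the separants do not vanish, the equations and the velocities of the
variables of the last block determine all velocities. -/
theorem exists_velocity (hS : S.IsBlockTriangular p lv le) {η : Jet V}
    (hη : firstJet η ∈ S.dom) (hη0 : ∀ e, S.P e (firstJet η) = 0)
    (hdet : ∀ h, 1 ≤ h → h ≤ p → ∃ σ : Block lv (h - 1) ≃ Block le h,
      ((S.jacobian lv le 1 h (h - 1) η).submatrix σ id).det ≠ 0) :
    ∃ ψ : (V → ℝ) × (V → ℝ) → V → ℝ,
      (∀ᶠ m in 𝓝 (η.2 0, η.2 1), ContDiffAt ℝ ∞ ψ m ∧ (![m.1, ψ m] : FirstJet V) ∈ S.dom ∧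
        ∀ e, S.P e ![m.1, ψ m] = 0) ∧
      ∀ᶠ m in 𝓝 (η.2 0, η.2 1), (∀ e, S.P e ![m.1, m.2] = 0) → ψ m = m.2 := by
  let L : ((V → ℝ) × (V → ℝ)) × (V → ℝ) →L[ℝ] FirstJet V :=
    ContinuousLinearMap.pi ![(ContinuousLinearMap.fst ℝ _ _).comp (ContinuousLinearMap.fst ℝ _ _),
      ContinuousLinearMap.snd ℝ _ _]
  have hL : ∀ v, L v = ![v.1.1, v.2] := fun v => by
    funext k
    fin_cases k <;> rfl
  let R : ((V → ℝ) × (V → ℝ)) × (V → ℝ) →L[ℝ] (Block lv p → ℝ) :=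
    ContinuousLinearMap.pi fun i => (ContinuousLinearMap.proj (R := ℝ) (φ := fun _ : V => ℝ) i).comp
      (ContinuousLinearMap.snd ℝ _ _ - (ContinuousLinearMap.snd ℝ _ _).comp
        (ContinuousLinearMap.fst ℝ _ _))
  have hR : ∀ v i, R v i = v.2 i - v.1.2 i := fun v i => rfl
  -- Parameters: the values and reference velocities; unknown: the velocities. Besides the
  -- equations, `F` requires agreement with the reference on the last block.
  let F : ((V → ℝ) × (V → ℝ)) × (V → ℝ) → (E → ℝ) × (Block lv p → ℝ) := fun v =>
    (fun e => S.P e (L v), R v)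
  set u : ((V → ℝ) × (V → ℝ)) × (V → ℝ) := ((η.2 0, η.2 1), η.2 1)
  have hLu : L u = firstJet η := by
    rw [hL]
    funext k
    fin_cases k <;> rfl
  have hFu : F u = 0 := by
    refine Prod.ext (funext fun e => ?_) (funext fun i => ?_)
    · exact (congrArg (S.P e) hLu).trans (hη0 e)
    · exact (hR u i).trans (sub_self _)
  -- Analyticity at a point, unlike `ContDiffAt` of order `∞`, persists on a neighbourhood, as
  -- needed for `ψ` below.
  have hFω : ContDiffAt ℝ ω F u := by
    refine ContDiffAt.prodMk (contDiffAt_pi.2 fun e => ?_) R.contDiff.contDiffAt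
    exact ContDiffAt.comp u (hLu.symm ▸ (S.analytic e _ hη).contDiffAt) L.contDiff.contDiffAt
  have hF' : HasFDerivAt F ((ContinuousLinearMap.pi fun e =>
      (fderiv ℝ (S.P e) (L u)).comp L).prod R) u := by
    refine HasFDerivAt.prodMk (hasFDerivAt_pi.2 fun e => ?_) R.hasFDerivAt
    exact HasFDerivAt.comp u (hLu.symm ▸
      (S.analytic e _ hη).differentiableAt.hasFDerivAt) L.hasFDerivAt
  have hinj : Function.Injective (fderiv ℝ F u ∘L .inr ℝ _ _) := by
    refine (injective_iff_map_eq_zero _).2 fun w hw => ?_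
    rw [hF'.fderiv] at hw
    have h1 : ∀ e, fderiv ℝ (S.P e) (L u) (L (0, w)) = 0 := fun e =>
      congrFun (congrArg Prod.fst hw) e
    have h2 : ∀ i : Block lv p, w i = 0 := fun i => by
      have := congrFun (congrArg Prod.snd hw) i
      simpa using (hR (0, w) i).symm.trans this
    funext v
    rcases (hS.lv_le v).lt_or_eq with hv | hv
    · refine eq_zero_of_blocks_right (M := fun e v => S.pd e 1 v (firstJet η))
        (fun e x h => hS.pd_one_eq_zero h hη) hdet (fun e => ?_) hv
      have h3 := h1 e
      rw [hLu, fderiv_P_apply, hL, Fin.sum_univ_two] at h3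
      simpa [mul_comm] using h3
    · exact h2 ⟨v, hv⟩
  have hcard : Module.finrank ℝ (V → ℝ) = Module.finrank ℝ ((E → ℝ) × (Block lv p → ℝ)) := by
    rw [Module.finrank_prod]
    simp only [Module.finrank_fintype_fun_eq_card]
    exact (card_eq_of_blocks (fun e => ⟨hS.one_le_le e, hS.le_le e⟩) hS.lv_le hS.card_eq).symm
  have hinv : (fderiv ℝ F u ∘L .inr ℝ _ _).IsInvertible :=
    ⟨(LinearEquiv.ofInjectiveOfFinrankEq (fderiv ℝ F u ∘L .inr ℝ _ _).toLinearMap hinj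
      hcard).toContinuousLinearEquiv, by ext1 w; rfl⟩
  have hω : (ω : ℕ∞ω) ≠ 0 := by simp
  have hψω := hFω.contDiffAt_implicitFunction hω hinv
  have hψu := hFω.implicitFunction_apply_self hω hinv
  have hev := hFω.eventually_apply_implicitFunction hω hinv
  have hiff := hFω.eventually_apply_eq_iff_implicitFunction hω hinv
  set ψ := hFω.implicitFunction hω hinv
  refine ⟨ψ, ?_, ?_⟩
  · have hc : ContinuousAt (fun m => L (m, ψ m)) u.1 :=
      L.continuous.continuousAt.comp (continuousAt_id.prodMk hψω.continuousAt)
    have hdom : ∀ᶠ m in 𝓝 u.1, L (m, ψ m) ∈ S.dom :=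
      hc.eventually_mem (S.isOpen_dom.mem_nhds (by rw [hψu]; exact hLu.symm ▸ hη))
    filter_upwards [hψω.eventually (by simp), hdom, hev] with m h1 h2 h3
    rw [hL] at h2
    refine ⟨h1.of_le le_top, h2, fun e => ?_⟩
    rw [← hL (m, ψ m)]
    exact congrFun (congrArg Prod.fst (h3.trans hFu)) e
  · have hc : ContinuousAt (fun m : (V → ℝ) × (V → ℝ) => (m, m.2)) u.1 := by fun_prop
    filter_upwards [hc.eventually hiff] with m hm h0
    refine hm.1 (Eq.trans (Prod.ext (funext fun e => ?_) (funext fun i => ?_)) hFu.symm)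
    · exact (congrArg (S.P e) (hL _)).trans (h0 e)
    · exact (hR _ i).trans (sub_self _)

/-- At a point of a trajectory where the separants do not vanish, the values of the variables
may be varied freely on the diffiety. -/
theorem IsTrajectory.exists_transverse_curve (hS : S.IsBlockTriangular p lv le) {I : Set ℝ}
    {x : ℝ → V → ℝ} (hx : S.IsTrajectory I x) {t₀ : ℝ} (ht₀ : t₀ ∈ I)
    (hdet : ∀ h, 1 ≤ h → h ≤ p → ∃ σ : Block lv (h - 1) ≃ Block le h,
      ((S.jacobian lv le 1 h (h - 1) (curveJet x t₀)).submatrix σ id).det ≠ 0) (a : V → ℝ) :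
    ∃ (q : ℝ → Jet V) (q' : Jet V), HasJetDeriv q q' 0 ∧ q 0 = curveJet x t₀ ∧
      (∀ᶠ s in 𝓝 0, q s ∈ S.diffiety) ∧ q'.1 = 0 ∧ q'.2 0 = a := by
  obtain ⟨ψ, hψ1, hψ2⟩ := exists_velocity (η := curveJet x t₀) hS (hx.mem_dom t₀ ht₀)
    (hx.solution t₀ ht₀) hdet
  have hx' : ContDiffOn ℝ ∞ (iteratedDeriv 1 x) I := by
    rw [iteratedDeriv_one]
    exact hx.smooth.deriv_of_isOpen hx.isOpen (by simp)
  have hxc : ContinuousAt x t₀ := hx.smooth.continuousOn.continuousAt (hx.isOpen.mem_nhds ht₀)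
  have hx'c : ContinuousAt (iteratedDeriv 1 x) t₀ :=
    hx'.continuousOn.continuousAt (hx.isOpen.mem_nhds ht₀)
  have hη : ((curveJet x t₀).2 0, (curveJet x t₀).2 1) = (x t₀, iteratedDeriv 1 x t₀) := by
    simp [curveJet]
  rw [hη] at hψ1 hψ2
  -- The last-block velocities are taken from the trajectory at the same time, so that the
  -- trajectory is an integral curve of `y`.
  let κ : ℝ × (V → ℝ) → (V → ℝ) × (V → ℝ) := fun m => (m.2, iteratedDeriv 1 x m.1)
  have hκ : ContinuousAt κ (t₀, x t₀) :=
    continuousAt_snd.prodMk (ContinuousAt.comp (f := Prod.fst) (g := iteratedDeriv 1 x)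
      (x := (t₀, x t₀)) hx'c continuousAt_fst)
  obtain ⟨W, hWψ, hW, hW0⟩ := mem_nhds_iff.1 ((hκ.eventually hψ1).and
    (continuousAt_fst.eventually_mem (hx.isOpen.mem_nhds ht₀)))
  let y : ℝ × (V → ℝ) → V → ℝ := fun m => ψ (κ m)
  have hy : ContDiffOn ℝ ∞ y W := by
    intro m hm
    have h1 : ContDiffAt ℝ ∞ κ m := contDiffAt_snd.prodMk
      (ContDiffAt.comp (f := Prod.fst) m (hx'.contDiffAt (hx.isOpen.mem_nhds (hWψ hm).2))
        contDiffAt_fst)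
    exact ((hWψ hm).1.1.comp m h1).contDiffWithinAt
  have hfj : ∀ m, firstJet (lieSection y m) = ![(κ m).1, ψ (κ m)] := by
    intro m
    funext k
    fin_cases k
    · rfl
    · exact lieJet_one m
  have hsub : lieSection y '' W ⊆ S.diffiety := by
    refine S.subset_diffiety_of_isCartanInvariant (isCartanInvariant_lieSection hW hy) ?_ ?_
    · rintro _ ⟨m, hm, rfl⟩
      rw [hfj]
      exact (hWψ hm).1.2.1
    · rintro _ ⟨m, hm, rfl⟩ e
      rw [hfj]
      exact (hWψ hm).1.2.2 e
  obtain ⟨K, hKx, hK, htK⟩ : ∃ K ⊆ {t | (t, x t) ∈ W ∧ HasDerivAt x (y (t, x t)) t},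
      IsOpen K ∧ t₀ ∈ K := by
    have h1 : ∀ᶠ t in 𝓝 t₀, (t, x t) ∈ W :=
      (continuousAt_id.prodMk hxc).eventually_mem (hW.mem_nhds hW0)
    have h2 := (hxc.prodMk hx'c).eventually hψ2
    refine mem_nhds_iff.1 ?_
    filter_upwards [h1, h2, hx.isOpen.mem_nhds ht₀] with t h1 h2 h3
    refine ⟨h1, ?_⟩
    have h4 : y (t, x t) = iteratedDeriv 1 x t := h2 fun e => by
      refine Eq.trans (congrArg (S.P e) (funext fun k => ?_)) (hx.solution t h3 e)
      fin_cases k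
      · simp
      · rfl
    rw [h4, iteratedDeriv_one]
    exact ((hx.smooth.contDiffAt (hx.isOpen.mem_nhds h3)).differentiableAt (by simp)).hasDerivAt
  have hc : HasDerivAt (fun s : ℝ => (t₀, x t₀ + s • a)) (0, a) 0 := by
    refine (hasDerivAt_const _ _).prodMk ?_
    simpa using ((hasDerivAt_id (0 : ℝ)).smul_const a).const_add (x t₀)
  have h0 : (t₀, x t₀ + (0 : ℝ) • a) = (t₀, x t₀) := by simp
  have hc0 : (t₀, x t₀ + (0 : ℝ) • a) ∈ W := h0.symm ▸ hW0
  refine ⟨fun s => lieSection y (t₀, x t₀ + s • a), _, hasJetDeriv_lieSection hW hy hc hc0, ?_, ?_,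
    rfl, ?_⟩
  · simp only [h0]
    exact lieSection_eq_curveJet hW hy hK (fun t ht => hKx ht) htK
  · filter_upwards [hc.continuousAt.eventually_mem (hW.mem_nhds hc0)] with s hs
      using hsub ⟨_, hs, rfl⟩
  · simp [lieJet, fderiv_snd]

end DiffSystem

/-! ### The torsion element. -/

namespace DiffSystem

variable {V E : Type*} [Fintype V] [DecidableEq V] {S : DiffSystem V E}

theorem linearizedEq_apply (η : Jet V) (e : E) (k : ℕ) (v : V) :
    S.linearizedEq η e (k, v) = ∑ l : Fin 2,
      if (l : ℕ) = k then taylorSeries η (fun q => S.pd e l v (firstJet q)) else 0 := by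
  rw [linearizedEq, Finsupp.finsetSum_apply]
  refine Finset.sum_congr rfl fun l _ => ?_
  rw [Finsupp.finsetSum_apply]
  simp [Finsupp.single_apply, ite_and]

variable [Fintype E] {p : ℕ} {lv : V → ℕ} {le : E → ℕ}

/-- At a point of a trajectory where the separants do not vanish, the linearized system implies
no linear relation between the variables without their derivatives. -/
theorem IsTrajectory.not_mem_linearizedRelations (hS : S.IsBlockTriangular p lv le) {I : Set ℝ}
    {x : ℝ → V → ℝ} (hx : S.IsTrajectory I x) {t₀ : ℝ} (ht₀ : t₀ ∈ I)
    (hdet : ∀ h, 1 ≤ h → h ≤ p → ∃ σ : Block lv (h - 1) ≃ Block le h,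
      ((S.jacobian lv le 1 h (h - 1) (curveJet x t₀)).submatrix σ id).det ≠ 0)
    {w : Forms V} (hw : ∀ j v, 0 < j → w (j, v) = 0) (hw0 : w ≠ 0) :
    w ∉ S.linearizedRelations (curveJet x t₀) := by
  refine fun hmem => hw0 (eq_zero_of_mem_span_of_order_zero (l := S.linearizedEq (curveJet x t₀))
    (fun e j v hj => ?_) (fun c hc => ?_) hw hmem)
  · rw [linearizedEq_apply]
    exact Finset.sum_eq_zero fun l _ => if_neg (by omega)
  · refine eq_zero_of_blocks_left (p := p) (lv := lv) (le := le)
      (M := fun e v => taylorSeries (curveJet x t₀) fun q => S.pd e 1 v (firstJet q))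
      (fun e => ⟨hS.one_le_le e, hS.le_le e⟩) (fun e v h => ?_) (fun h h1 h2 => ?_)
      (fun v => by simpa [linearizedEq_apply] using hc v)
    · rw [hx.taylorSeries_eq_C (contDiffOn_pd e 1 v) (a := 0)
        (fun t ht => hS.pd_one_eq_zero h (hx.mem_dom t ht)) ht₀, map_zero]
    · obtain ⟨σ, hσ⟩ := hdet h h1 h2
      refine ⟨σ, fun h0 => hσ ?_⟩
      -- The constant coefficient of the determinant over `ℝ⟦τ⟧` is the Jacobian determinant at `η`.
      have h3 := congrArg (PowerSeries.constantCoeff (R := ℝ)) h0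
      rw [RingHom.map_det, map_zero] at h3
      refine Eq.trans (congrArg Matrix.det (Matrix.ext fun i j => ?_)) h3
      simp [jacobian, taylorSeries]

/-- A combination of the linearized equations with constant coefficients and without terms of
order zero provides a torsion element. -/
theorem linearizedHasTorsion_of_combination {η : Jet V} {γ : E → ℝ} {b : Fin 2 → V → ℝ}
    (hγ : ∀ k v, ∑ e, PowerSeries.C (γ e) *
      taylorSeries η (fun q => S.pd e k v (firstJet q)) = PowerSeries.C (b k v))
    (hb : ∀ v, b 0 v = 0)
    (hw : ∑ v, Finsupp.single (0, v) (PowerSeries.C (b 1 v)) ∉ S.linearizedRelations η) :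
    S.LinearizedHasTorsion η := by
  -- The annihilating operator is `d/dτ` itself; the coefficients being constant, the derivative has
  -- only terms of order one.
  refine ⟨_, hw, Finsupp.single 1 1, by simp, ?_⟩
  have h1 : opApply (Finsupp.single 1 1) (∑ v, Finsupp.single (0, v) (PowerSeries.C (b 1 v))) =
      ∑ e, PowerSeries.C (γ e) • S.linearizedEq η e := by
    rw [opApply, Finsupp.sum_single_index (by simp), one_smul, Function.iterate_one, formDeriv_sum]
    ext1 ⟨k, v⟩
    have h2 : ∀ k v, (∑ e, PowerSeries.C (γ e) • S.linearizedEq η e) (k, v) =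
        ∑ l : Fin 2, if (l : ℕ) = k then PowerSeries.C (b l v) else 0 := by
      intro k v
      rw [Finsupp.finsetSum_apply]
      simp only [Finsupp.smul_apply, linearizedEq_apply, smul_eq_mul, Finset.mul_sum]
      rw [Finset.sum_comm]
      refine Finset.sum_congr rfl fun l _ => ?_
      split_ifs with h
      · exact hγ l v
      · simp
    rw [h2, Fin.sum_univ_two, hb, Finsupp.finsetSum_apply]
    simp [formDeriv_single, Finsupp.single_apply, ite_and]
  rw [h1]
  exact Submodule.sum_mem _ fun e _ => Submodule.smul_mem _ _
    (Submodule.subset_span ⟨e, 0, rfl⟩)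

end DiffSystem

end FlatSing

end

/-! ### The theorem. -/

open FlatSing in
theorem mainTheorem3 {V E : Type*} [Fintype V] [DecidableEq V] [Fintype E]
    (S : DiffSystem V E) (p : ℕ) (lv : V → ℕ) (le : E → ℕ)
    (hS : S.IsBlockTriangular p lv le)
    (h₀ : ℕ) (h₀_ge : 2 ≤ h₀) (h₀_le : h₀ ≤ p)
    (hchained : S.IsChainedAt lv le h₀)
    (hstrict : S.IsStrictlyChainedAt lv le (h₀ - 1))
    (I : Set ℝ) (x : ℝ → V → ℝ) (hx : S.IsTrajectory I x)
    (hconst : ∀ (e : E) (k : Fin 2) (v : V), le e = h₀ - 1 ∨ le e = h₀ →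
      S.AppearsNonlinearly e k v →
      ∃ c : ℝ, ∀ t ∈ I, iteratedDeriv k x t v = c)
    (t₀ : ℝ) (ht₀ : t₀ ∈ I) (η : Jet V) (hη : η = curveJet x t₀)
    (hrank : (S.jacobian lv le 0 h₀ h₀ η).rank < Nat.card (Block lv (h₀ - 2)))
    (hdet : ∀ h, 1 ≤ h → h ≤ p → ∃ σ : Block lv (h - 1) ≃ Block le h,
      ((S.jacobian lv le 1 h (h - 1) η).submatrix σ id).det ≠ 0) :
    S.LinearizedHasTorsion η ∧ ¬ IsFlatAt S.diffiety η := by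
  subst hη
  have hdom : ∀ t ∈ I, firstJet (curveJet x t) ∈ S.dom := hx.mem_dom
  obtain ⟨γ, hγ0, hγ, hγz⟩ := DiffSystem.exists_combination hS h₀_ge h₀_le hchained hstrict
    (hdom t₀ ht₀) hrank
  have hpd : ∀ e k v, ∀ t ∈ I, γ e * S.pd e k v (firstJet (curveJet x t)) =
      γ e * S.pd e k v (firstJet (curveJet x t₀)) := by
    intro e k v t ht
    by_cases h : le e = h₀ - 1 ∨ le e = h₀
    · rw [hx.pd_eq (fun k v => hconst e k v h) k v ht ht₀]
    · rw [hγ e (fun h' => h (Or.inl h')) (fun h' => h (Or.inr h')), zero_mul, zero_mul]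
  set b : Fin 2 → V → ℝ := fun k v => ∑ e, γ e * S.pd e k v (firstJet (curveJet x t₀))
  -- Otherwise `γ` would be a left null vector of the invertible-block matrix of the `∂P/∂x'`.
  have hb : ∃ v, b 1 v ≠ 0 := by
    by_contra! h
    exact hγ0 (eq_zero_of_blocks_left (p := p)
      (M := fun e v => S.pd e 1 v (firstJet (curveJet x t₀)))
      (fun e => ⟨hS.one_le_le e, hS.le_le e⟩)
      (fun e v h => hS.pd_one_eq_zero h (hdom t₀ ht₀)) hdet h)
  constructor
  · refine DiffSystem.linearizedHasTorsion_of_combination (γ := γ) (b := b) (fun k v => ?_) hγz ?_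
    · simp only [b, map_sum]
      refine Finset.sum_congr rfl fun e _ => ?_
      by_cases h : le e = h₀ - 1 ∨ le e = h₀
      · rw [hx.taylorSeries_eq_C (DiffSystem.contDiffOn_pd e k v)
          (fun t ht => hx.pd_eq (fun k v => hconst e k v h) k v ht ht₀) ht₀, map_mul]
      · rw [hγ e (fun h' => h (Or.inl h')) (fun h' => h (Or.inr h')), zero_mul, map_zero, zero_mul]
    · refine hx.not_mem_linearizedRelations hS ht₀ hdet (fun j v hj => ?_) (fun h => ?_)
      · rw [Finsupp.finsetSum_apply]
        exact Finset.sum_eq_zero fun u _ => Finsupp.single_eq_of_ne (by simp; omega)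
      · obtain ⟨v, hv⟩ := hb
        refine hv ?_
        have := DFunLike.congr_fun h (0, v)
        simpa [Finsupp.single_apply] using this
  -- The direction `b 1` makes the derivative of `∑ b_v x_v` along `q` a nonzero sum of squares.
  · obtain ⟨q, q', hq, hq0, hqX, hqt, hqa⟩ :=
      hx.exists_transverse_curve hS ht₀ hdet (b 1)
    refine not_isFlatAt_of_deriv_eq_zero hx.isOpen ht₀ rfl
      (fun t ht => hx.curveJet_mem_diffiety ht)
      (fun t ht => hasJetDeriv_curveJet hx.isOpen hx.smooth ht) (b 1) ?_ hq hq0 hqX hqt ?_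
    · intro t ht r w hr hrX hw
      have hP : ∀ e, fderiv ℝ (S.P e) (firstJet (curveJet x t)) w = 0 := by
        intro e
        have h1 : HasFDerivAt (S.P e) (fderiv ℝ (S.P e) (firstJet (curveJet x t)))
            (firstJet (r 0)) := by
          rw [hr]
          exact (S.analytic e _ (hdom t ht)).differentiableAt.hasFDerivAt
        refine (HasFDerivAt.comp_hasDerivAt (f := fun s => firstJet (r s)) 0 h1 hw).unique ?_
        refine (hasDerivAt_const (0 : ℝ) (0 : ℝ)).congr_of_eventuallyEq ?_
        filter_upwards [hrX] with s hs using hs.2 e 0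
      have h2 : ∑ e, γ e * fderiv ℝ (S.P e) (firstJet (curveJet x t)) w = 0 :=
        Finset.sum_eq_zero fun e _ => by rw [hP, mul_zero]
      have h3 : ∑ e, γ e * fderiv ℝ (S.P e) (firstJet (curveJet x t)) w =
          ∑ k, ∑ v, b k v * w k v := by
        simp only [DiffSystem.fderiv_P_apply, Finset.mul_sum, b, Finset.sum_mul]
        rw [Finset.sum_comm]
        refine Finset.sum_congr rfl fun k _ => ?_
        rw [Finset.sum_comm]
        refine Finset.sum_congr rfl fun v _ => Finset.sum_congr rfl fun e _ => ?_
        rw [← hpd e k v t ht]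
        ring
      have h4 : ∑ v, b 0 v * w 0 v = 0 :=
        Finset.sum_eq_zero fun v _ => by rw [show b 0 v = 0 from hγz v, zero_mul]
      rwa [h3, Fin.sum_univ_two, h4, zero_add] at h2
    · rw [hqa]
      obtain ⟨v, hv⟩ := hb
      exact (Finset.sum_pos' (fun v _ => mul_self_nonneg (b 1 v))
        ⟨v, Finset.mem_univ v, mul_self_pos.2 hv⟩).ne'
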